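/- Theorem 2. Let $Q_2^n=\{0,1\}^n$. A face of dimension $n-k$ is given by a tuple $a\in\{0,1,*\}^n$ with exactly $n-k$ symbols $*$; it consists of all $x\in Q_2^n$ with $x_i=a_i$ whenever $a_i\in\{0,1\}$. Two faces are parallel if their symbols $*$ occupy the same positions; parallel faces are antipodal if the antipode of each vertex of one lies in the other. An antipodal $k$-splitting of $Q_2^n$ is a set $A$ of exactly $2^k$ faces of dimension $n-k$ which covers $Q_2^n$ and in which any two distinct parallel faces are antipodal. Put $\beta(a)=\{i: a_i\in\{0,1\}\}$ and $\beta(A)=\{\beta(a): a\in A\}$. A $k$-unitrade on a set $V$ is a collection of $k$-subsets of $V$ such that each $(k-1)$-subset of $V$ is contained in an even number of them. Collections $U_1$ on $V_1$ and $U_2$ on $V_2$ are equivalent if $U_2=\{f(u):u\in U_1\}$ for some injection $f:V_1\to V_2$. Let $E$ and $F$ be the following collections of 5-subsets of $\{1,\dots,8\}$ (written without braces and commas): $E=\{12356,\,12456,\,13456,\,23456,\,12357,\,12457,\,13457,\,23457,\,12367,\,12467,\,13467,\,23468,\,23478,\,23678,\,24678,\,34678\}$, $F=\{12357,\,12457,\,13457,\,23457,\,12367,\,12467,\,13467,\,23467,\,12368,\,12468,\,13468,\,23468,\,12358,\,12458,\,13458,\,23458\}$.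 (i) $E$ and $F$ are $5$-unitrades, and if $A$ is an antipodal $5$-splitting of $Q_2^n$ (for any $n$), then $\beta(A)$ is equivalent to $E$ or to $F$. (ii) A hypergraph $G$ (finite, without multiple edges) is 2-DP-colorable if for every choice of maps $\varphi_e:e\to\{0,1\}$, one for each edge $e$, there is a map $f:V(G)\to\{0,1\}$ such that $f|_e\ne\varphi_e$ and $f|_e\ne\varphi_e\oplus 1$ for every edge $e$. Up to isomorphism, and disregarding isolated vertices, there are exactly two non-2-DP-colorable $5$-uniform hypergraphs with $16$ edges, namely the hypergraphs on $\{1,\dots,8\}$ with edge sets $E$ and $F$: these two are non-2-DP-colorable and not isomorphic, and every non-2-DP-colorable $5$-uniform hypergraph with $16$ edges becomes isomorphic to one of them after its isolated vertices are deleted. -/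

import Mathlib

/-- The vertices of the Boolean hypercube `Q_2^n`. -/
abbrev Cube (n : ℕ) : Type := Fin n → Bool

/-- A face of `Q_2^n`: an `n`-tuple of symbols `0`, `1`, `*`, where `none` stands for `*`. -/
abbrev Face (n : ℕ) : Type := Fin n → Option Bool

/-- The set of vertices of a face: `x` lies in `a` if `x_i = a_i` whenever `a_i` is `0` or `1`. -/
def Face.verts {n : ℕ} (a : Face n) : Set (Cube n) :=
  {x | ∀ i c, a i = some c → x i = c}

/-- The block `β(a)` of a face: the positions `i` with `a_i ∈ {0,1}`. -/
def Face.block {n : ℕ} (a : Face n) : Finset (Fin n) :=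
  Finset.univ.filter fun i => a i ≠ none

/-- The dimension of a face: the number of symbols `*`. -/
def Face.dim {n : ℕ} (a : Face n) : ℕ :=
  (Finset.univ.filter fun i => a i = none).card

/-- Two faces are parallel if they have the same directions (the symbols `*` are in the same
positions). -/
def Face.Parallel {n : ℕ} (a b : Face n) : Prop :=
  ∀ i, a i = none ↔ b i = none

/-- The antipodal vertex. -/
def Cube.antipode {n : ℕ} (x : Cube n) : Cube n := fun i => !x i

/-- Two parallel faces are antipodal if the antipode of each vertex of one lies in the other. -/
def Face.Antipodal {n : ℕ} (a b : Face n) : Prop :=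
  a.Parallel b ∧ (∀ x ∈ a.verts, Cube.antipode x ∈ b.verts) ∧
    (∀ x ∈ b.verts, Cube.antipode x ∈ a.verts)

/-- An antipodal `k`-splitting of `Q_2^n`: a covering of `Q_2^n` by exactly `2^k` faces of
dimension `n - k`, without pairs of parallel non-antipodal faces. -/
structure IsAntipodalSplitting (k n : ℕ) (A : Finset (Face n)) : Prop where
  dim_eq : ∀ a ∈ A, a.dim + k = n
  card_eq : A.card = 2 ^ k
  covers : ∀ x : Cube n, ∃ a ∈ A, x ∈ a.verts
  antipodal : ∀ a ∈ A, ∀ b ∈ A, a ≠ b → a.Parallel b → a.Antipodal b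

/-- The block system `β(A) = {β(a) : a ∈ A}`. -/
def blockSystem {n : ℕ} (A : Finset (Face n)) : Finset (Finset (Fin n)) :=
  A.image Face.block

/-- A collection `U` of `k`-subsets of `V` is a `k`-unitrade if every `(k-1)`-subset of `V` is
contained in an even number of blocks of `U`. -/
def IsUnitrade {V : Type*} [DecidableEq V] (k : ℕ) (U : Finset (Finset V)) : Prop :=
  (∀ u ∈ U, u.card = k) ∧
    ∀ s : Finset V, s.card + 1 = k → Even (U.filter fun u => s ⊆ u).card

/-- `U₁` on `V₁` and `U₂` on `V₂` are equivalent if `U₂ = {f(u) : u ∈ U₁}` for some injection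
`f : V₁ → V₂`. -/
def UnitradeEquiv {V₁ V₂ : Type*} (U₁ : Finset (Finset V₁)) (U₂ : Finset (Finset V₂)) : Prop :=
  ∃ f : V₁ ↪ V₂, U₂ = U₁.map (Finset.mapEmbedding f).toEmbedding

/-- The unitrade `E`; the element `i : Fin 8` stands for the point `i + 1` of `{1, …, 8}`. -/
def unitradeE : Finset (Finset (Fin 8)) :=
  {{0, 1, 2, 4, 5}, {0, 1, 3, 4, 5}, {0, 2, 3, 4, 5}, {1, 2, 3, 4, 5},
   {0, 1, 2, 4, 6}, {0, 1, 3, 4, 6}, {0, 2, 3, 4, 6}, {1, 2, 3, 4, 6},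
   {0, 1, 2, 5, 6}, {0, 1, 3, 5, 6}, {0, 2, 3, 5, 6},
   {1, 2, 3, 5, 7}, {1, 2, 3, 6, 7}, {1, 2, 5, 6, 7}, {1, 3, 5, 6, 7}, {2, 3, 5, 6, 7}}

/-- The unitrade `F`; the element `i : Fin 8` stands for the point `i + 1` of `{1, …, 8}`. -/
def unitradeF : Finset (Finset (Fin 8)) :=
  {{0, 1, 2, 4, 6}, {0, 1, 3, 4, 6}, {0, 2, 3, 4, 6}, {1, 2, 3, 4, 6},
   {0, 1, 2, 5, 6}, {0, 1, 3, 5, 6}, {0, 2, 3, 5, 6}, {1, 2, 3, 5, 6},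
   {0, 1, 2, 5, 7}, {0, 1, 3, 5, 7}, {0, 2, 3, 5, 7}, {1, 2, 3, 5, 7},
   {0, 1, 2, 4, 7}, {0, 1, 3, 4, 7}, {0, 2, 3, 4, 7}, {1, 2, 3, 4, 7}}

namespace Hypergraph

/-- `H` is `k`-uniform: every edge has exactly `k` vertices. -/
def IsUniform {α : Type*} (H : Hypergraph α) (k : ℕ) : Prop :=
  ∀ e ∈ H.edgeSet, e.encard = k

/-- The restriction `f|_e` of a 2-coloring `f` of the vertices to an edge `e`. -/
def restrictColoring {α : Type*} (H : Hypergraph α) (f : H.vertexSet → Bool) (e : H.edgeSet) :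
    e.1 → Bool :=
  fun v => f ⟨v.1, H.subset_vertexSet_of_mem_edgeSet' e.2 v.2⟩

/-- `H` is 2-DP-colorable: for every collection `Φ` of 2-colorings `φ_e : e → {0,1}` of the edges
there is a 2-coloring `f` of the vertices with `f|_e ≠ φ_e` and `f|_e ≠ φ_e ⊕ 1` for each
edge `e`. -/
def IsTwoDPColorable {α : Type*} (H : Hypergraph α) : Prop :=
  ∀ Φ : (e : H.edgeSet) → (e.1 → Bool), ∃ f : H.vertexSet → Bool, ∀ e : H.edgeSet,
    H.restrictColoring f e ≠ Φ e ∧ H.restrictColoring f e ≠ fun v => !(Φ e v)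

/-- Two hypergraphs are isomorphic if some bijection between their vertex sets maps edges to edges
and non-edges to non-edges. -/
def Isomorphic {α β : Type*} (G : Hypergraph α) (H : Hypergraph β) : Prop :=
  ∃ φ : G.vertexSet ≃ H.vertexSet, ∀ s : Set G.vertexSet,
    Subtype.val '' s ∈ G.edgeSet ↔ Subtype.val '' (φ '' s) ∈ H.edgeSet

/-- The hypergraph obtained from `H` by deleting its isolated vertices, i.e. the vertices that lie
in no edge. -/
def deleteIsolated {α : Type*} (H : Hypergraph α) : Hypergraph α where
  vertexSet := ⋃₀ H.edgeSet
  edgeSet := H.edgeSet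
  subset_vertexSet_of_mem_edgeSet' := fun _ he => Set.subset_sUnion_of_mem he

/-- The hypergraph on the vertex set `V` whose edges are the blocks of `U`. -/
def ofBlocks {V : Type*} (U : Finset (Finset V)) : Hypergraph V where
  vertexSet := Set.univ
  edgeSet := {e | ∃ u ∈ U, (u : Set V) = e}
  subset_vertexSet_of_mem_edgeSet' := fun _ _ => Set.subset_univ _

end Hypergraph

/-!
Write a vertex of the cube as the set `X` of the positions of its ones; a face is then given by its
block `B` and a set `N ⊆ B`, and consists of the `X` with `X ∩ B = N`. Both parts of the theorem
are about the same situation: 16 pairs of antipodal faces, `X ∩ B = N` and `X ∩ B = B \ N`, with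
distinct blocks of size 5, that cover the cube. For a splitting, the Fourier coefficient of the
covering at a block shows that each face occurs together with its antipode
(`IsAntipodalSplitting.exists_ne`), so that there are 16 blocks; for a hypergraph with edge
colorings `φ_e`, the colorings that agree with `φ_e` or `φ_e ⊕ 1` on `e` form such a pair of faces.

A covering by 32 faces of codimension 5 is a partition. Hence any two of the faces differ at a
common fixed coordinate, and the Fourier coefficients of degree 4 of the covering vanish; this means
that each 4-set `S` is contained in as many blocks `S + v` that give `v` the sign `+` as in
blocks that give it the sign `-`, if among `N` and `B \ N` the set of even size is chosen. These two
properties define a `SignedSystem`, and `signedSystem_of_cover` says that a covering gives one.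

The blocks of a signed system are then determined in two steps.

* Each 4-set `S` lies in at most two blocks (`SignedSystem.blockDegree_le_two`). Otherwise there are
  two positive and two negative blocks containing `S`. Inverting coordinates and renumbering
  the points brings these four to one of two configurations, and an exhaustive search
  (`signedSearch`) shows that neither of them is part of a signed system: it adds, in all
  possible ways, blocks that restore the balance at some 4-set.

* If each covered 4-set lies in exactly two blocks, one positive and one negative, then signs can
  nearly be forgotten. What remains of them is that a subfamily of the blocks that covers each 4-set
  an even number of times has a size divisible by 4 (`SignedSystem.four_dvd_card_of_even`). Together
  with the facts that two blocks share at least two points and that 40 4-sets are covered, this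
  suffices for a second search (`blockSearch`), which starts from one block and finds copies of `E`
  and `F` only.

Both searches represent sets by bit masks and are evaluated by the kernel; `evalNat` forces the
evaluation of intermediate results. Their soundness is proved by following the branch that belongs
to a given signed system (`not_signedInvariant_of_signedSearch`, `unitradeEquiv_of_blockSearch`).
New points are introduced in their natural order, which is no restriction since a point not used so
far can be exchanged with the next new one.
-/

/-! ### Finite sets of naturals as bit masks -/

/-- The finite set of positions of the ones in the binary expansion of `m`. -/
def bits (m : ℕ) : Finset ℕ := m.bitIndices.toFinset

@[simp] theorem mem_bits {i m : ℕ} : i ∈ bits m ↔ m.testBit i = true := by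
  simp [bits]

theorem bits_injective : Function.Injective bits := fun a b h =>
  Nat.eq_of_testBit_eq fun i => by
    have := Finset.ext_iff.1 h i
    rw [mem_bits, mem_bits] at this
    exact Bool.eq_iff_iff.2 this

theorem bits_sum_two_pow (s : Finset ℕ) : bits (∑ i ∈ s, 2 ^ i) = s :=
  Finset.toFinset_bitIndices_sum_two_pow s

theorem sum_bits (m : ℕ) : ∑ i ∈ bits m, 2 ^ i = m :=
  Finset.sum_toFinset_bitIndices_two_pow m

theorem exists_bits_eq (s : Finset ℕ) : ∃ m, bits m = s := ⟨_, bits_sum_two_pow s⟩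

theorem bits_zero : bits 0 = ∅ := by ext; simp

theorem bits_two_pow (i : ℕ) : bits (2 ^ i) = {i} := by
  ext j; simp [Nat.testBit_two_pow, eq_comm]

theorem bits_land (a b : ℕ) : bits (Nat.land a b) = bits a ∩ bits b := by
  ext j
  change _ ∈ bits (a &&& b) ↔ _
  simp

theorem bits_lor (a b : ℕ) : bits (Nat.lor a b) = bits a ∪ bits b := by
  ext j
  change _ ∈ bits (a ||| b) ↔ _
  simp

theorem bits_xor (a b : ℕ) : bits (Nat.xor a b) = symmDiff (bits a) (bits b) := by
  ext j
  have : Nat.xor a b = a ^^^ b := rfl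
  simp only [this, mem_bits, Nat.testBit_xor, Finset.mem_symmDiff]
  cases a.testBit j <;> cases b.testBit j <;> simp

theorem bits_add_two_pow {m i : ℕ} (h : i ∉ bits m) : bits (m + 2 ^ i) = insert i (bits m) := by
  rw [← bits_sum_two_pow (insert i (bits m)), Finset.sum_insert h, sum_bits, add_comm]

theorem bits_sub_two_pow {m i : ℕ} (h : i ∈ bits m) : bits (m - 2 ^ i) = (bits m).erase i := by
  rw [← bits_sum_two_pow ((bits m).erase i)]
  congr 1
  have := Finset.sum_erase_add (bits m) (fun i => 2 ^ i) h
  rw [sum_bits] at this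
  omega

theorem bits_eq_empty {m : ℕ} : bits m = ∅ ↔ m = 0 := by
  rw [← bits_zero, bits_injective.eq_iff]

theorem bits_subset_range {m n : ℕ} : bits m ⊆ Finset.range n ↔ m < 2 ^ n := by
  constructor
  · intro h
    refine Nat.lt_pow_two_of_testBit m fun i hi => ?_
    by_contra hc
    have := h (mem_bits.2 (by simpa using hc) : i ∈ bits m)
    simp at this
    omega
  · intro h i hi
    by_contra hc
    rw [Finset.mem_range, not_lt] at hc
    have := Nat.testBit_lt_two_pow (lt_of_lt_of_le h (Nat.pow_le_pow_right two_pos hc))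
    simp [this] at hi

/-- Clearing the lowest one of `x` leaves a nonzero number exactly if `x` has two ones. -/
theorem land_sub_one_eq_zero {x : ℕ} : Nat.land x (Nat.sub x 1) = 0 ↔ (bits x).card ≤ 1 := by
  have e : Nat.land x (Nat.sub x 1) = x &&& (x - 1) := rfl
  rw [e]
  rcases eq_or_ne x 0 with rfl | hx
  · simp [bits_zero]
  rw [Nat.and_sub_one_eq_zero_iff_isPowerOfTwo hx, Finset.card_le_one_iff_subset_singleton]
  constructor
  · rintro ⟨k, rfl⟩
    exact ⟨k, by rw [bits_two_pow]⟩
  · rintro ⟨k, hk⟩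
    rcases Finset.subset_singleton_iff.1 hk with h | h
    · exact absurd (bits_eq_empty.1 h) hx
    · exact ⟨k, bits_injective (by rw [h, bits_two_pow])⟩

/-! ### Signed block systems -/

/-- A signed block `(B, N)` encodes the pair of antipodal faces consisting of the vertex sets `X`
with `X ∩ B = N` and with `X ∩ B = B \ N`; for `|B|` odd, exactly one of `N` and `B \ N` has even
size, and that one is chosen. A signed system is a family of 16 such pairs of antipodal faces of
codimension 5, with distinct blocks, in which the faces are pairwise disjoint. The condition
`balance` says that the Fourier coefficients of degree 4 of the covering function vanish. -/
structure SignedSystem {V : Type*} [DecidableEq V] (T : Finset (Finset V × Finset V)) : Prop where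
  card_eq : T.card = 16
  card_block : ∀ p ∈ T, p.1.card = 5
  subset : ∀ p ∈ T, p.2 ⊆ p.1
  even : ∀ p ∈ T, Even p.2.card
  eq_of_fst : ∀ p ∈ T, ∀ q ∈ T, p.1 = q.1 → p = q
  conflict : ∀ p ∈ T, ∀ q ∈ T, p ≠ q →
    ∃ i ∈ p.1 ∩ q.1, ∃ j ∈ p.1 ∩ q.1, (i ∈ p.2 ↔ i ∈ q.2) ∧ ¬(j ∈ p.2 ↔ j ∈ q.2)
  balance : ∀ S : Finset V, S.card = 4 →
    (T.filter fun p => S ⊆ p.1 ∧ p.2 ⊆ S).card = (T.filter fun p => S ⊆ p.1 ∧ ¬ p.2 ⊆ S).card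

/-- The number of blocks of the family `U` that contain `S`. -/
def blockDegree {V : Type*} [DecidableEq V] (U : Finset (Finset V)) (S : Finset V) : ℕ :=
  (U.filter fun B => S ⊆ B).card

section

variable {V : Type*} [DecidableEq V]

theorem blockDegree_mono {P U : Finset (Finset V)} (h : P ⊆ U) (S : Finset V) :
    blockDegree P S ≤ blockDegree U S :=
  Finset.card_le_card (Finset.filter_subset_filter _ h)

theorem blockDegree_insert {P : Finset (Finset V)} {B : Finset V} (hB : B ∉ P) (S : Finset V) :
    blockDegree (insert B P) S = blockDegree P S + if S ⊆ B then 1 else 0 := by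
  unfold blockDegree
  rw [Finset.filter_insert]
  split_ifs with h
  · rw [Finset.card_insert_of_notMem (by simp [hB])]
  · simp

theorem blockDegree_sdiff {P U : Finset (Finset V)} (h : P ⊆ U) (S : Finset V) :
    blockDegree (U \ P) S + blockDegree P S = blockDegree U S := by
  unfold blockDegree
  rw [← Finset.card_union_of_disjoint
    (Finset.disjoint_filter_filter Finset.sdiff_disjoint), ← Finset.filter_union,
    Finset.sdiff_union_of_subset h]

theorem blockDegree_pos {P : Finset (Finset V)} {S : Finset V} :
    0 < blockDegree P S ↔ ∃ B ∈ P, S ⊆ B := by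
  simp [blockDegree, Finset.card_pos, Finset.Nonempty, Finset.mem_filter]

theorem exists_eq_insert_of_subset {S B : Finset V} (h : S ⊆ B)
    (hc : B.card = S.card + 1) : ∃ v ∉ S, B = insert v S := by
  obtain ⟨v, hv⟩ := Finset.card_eq_one.1 (by
    rw [Finset.card_sdiff_of_subset h]; omega : (B \ S).card = 1)
  have hvB : v ∈ B \ S := by rw [hv]; exact Finset.mem_singleton_self v
  exact ⟨v, (Finset.mem_sdiff.1 hvB).2, by
    rw [Finset.insert_eq, ← hv, Finset.sdiff_union_of_subset h]⟩

/-- The subsets of `B` of size `|B| - 1` are the sets `B.erase i`. -/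
theorem powersetCard_eq_image_erase {B : Finset V} {k : ℕ} (hB : B.card = k + 1) :
    B.powersetCard k = B.image B.erase := by
  ext S
  simp only [Finset.mem_powersetCard, Finset.mem_image]
  constructor
  · rintro ⟨hS, hc⟩
    obtain ⟨i, hi⟩ := Finset.card_eq_one.1 (by rw [Finset.card_sdiff_of_subset hS]; omega :
      (B \ S).card = 1)
    refine ⟨i, ?_, ?_⟩
    · exact (Finset.mem_sdiff.1 (hi ▸ Finset.mem_singleton_self i)).1
    · rw [← Finset.sdiff_singleton_eq_erase, ← hi, Finset.sdiff_sdiff_eq_self hS]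
  · rintro ⟨i, hi, rfl⟩
    exact ⟨Finset.erase_subset _ _, by rw [Finset.card_erase_of_mem hi, hB]; rfl⟩

/-- In a nonempty family of 5-sets that covers each 4-set an even number of times, the five
4-subsets of a block lie in five different other blocks. -/
theorem six_le_card_of_even {Q : Finset (Finset V)} (hQ : Q.Nonempty)
    (h5 : ∀ B ∈ Q, B.card = 5) (hev : ∀ S : Finset V, S.card = 4 → Even (blockDegree Q S)) :
    6 ≤ Q.card := by
  obtain ⟨B, hB⟩ := hQ
  have key : ∀ i ∈ B, ∃ C ∈ Q.erase B, B.erase i ⊆ C := by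
    intro i hi
    have h4 : (B.erase i).card = 4 := by rw [Finset.card_erase_of_mem hi, h5 B hB]
    have h1 := hev _ h4
    have h2 := blockDegree_insert (Finset.notMem_erase B Q) (B.erase i)
    rw [Finset.insert_erase hB, if_pos (Finset.erase_subset _ _)] at h2
    rw [h2] at h1
    apply blockDegree_pos.1
    by_contra h0
    have : blockDegree (Q.erase B) (B.erase i) = 0 := by omega
    rw [this] at h1
    exact absurd h1 (by decide)
  choose! f hf hsub using key
  have hinj : Set.InjOn f B := by
    intro i hi j hj hij
    by_contra hne
    have hBC : B ⊆ f i := by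
      intro x hx
      by_cases hxi : x = i
      · rw [hij]
        exact hsub j hj (Finset.mem_erase.2 ⟨by rw [hxi]; exact hne, hx⟩)
      · exact hsub i hi (Finset.mem_erase.2 ⟨hxi, hx⟩)
    have hC := Finset.mem_erase.1 (hf i hi)
    exact hC.1 (Finset.eq_of_subset_of_card_le hBC (by rw [h5 _ hC.2, h5 B hB])).symm
  have := Finset.card_le_card_of_injOn f (fun i hi => hf i hi) hinj
  rw [h5 B hB, Finset.card_erase_of_mem hB] at this
  omega

/-- Double counting of the incidences between 4-sets and the blocks containing them. -/
theorem sum_blockDegree {P : Finset (Finset V)} (h5 : ∀ B ∈ P, B.card = 5) :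
    ∑ S ∈ P.biUnion (Finset.powersetCard 4), blockDegree P S = 5 * P.card := by
  have h := Finset.sum_card_bipartiteAbove_eq_sum_card_bipartiteBelow
    (s := P.biUnion (Finset.powersetCard 4)) (t := P) (fun S B => S ⊆ B)
  have h' : ∀ B ∈ P, (Finset.bipartiteBelow (fun S B => S ⊆ B)
      (P.biUnion (Finset.powersetCard 4)) B).card = 5 := by
    intro B hB
    have : Finset.bipartiteBelow (fun S B => S ⊆ B) (P.biUnion (Finset.powersetCard 4)) B
        = B.powersetCard 4 := by
      ext S
      simp only [Finset.bipartiteBelow, Finset.mem_filter, Finset.mem_biUnion,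
        Finset.mem_powersetCard]
      constructor
      · rintro ⟨⟨C, -, -, h4⟩, hS⟩
        exact ⟨hS, h4⟩
      · rintro ⟨hS, h4⟩
        exact ⟨⟨B, hB, hS, h4⟩, hS⟩
    rw [this, Finset.card_powersetCard, h5 B hB]
    rfl
  rw [Finset.sum_congr rfl h', Finset.sum_const, smul_eq_mul, mul_comm] at h
  exact h

namespace SignedSystem

variable {T : Finset (Finset V × Finset V)}

theorem injOn_fst (hT : SignedSystem T) : Set.InjOn Prod.fst (T : Set (Finset V × Finset V)) :=
  fun p hp q hq h => hT.eq_of_fst p hp q hq h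

theorem card_blocks (hT : SignedSystem T) : (T.image Prod.fst).card = 16 := by
  rw [Finset.card_image_of_injOn hT.injOn_fst, hT.card_eq]

theorem card_of_mem_blocks (hT : SignedSystem T) {B : Finset V} (hB : B ∈ T.image Prod.fst) :
    B.card = 5 := by
  obtain ⟨p, hp, rfl⟩ := Finset.mem_image.1 hB
  exact hT.card_block p hp

theorem blockDegree_eq (hT : SignedSystem T) (S : Finset V) :
    blockDegree (T.image Prod.fst) S = (T.filter fun p => S ⊆ p.1).card := by
  unfold blockDegree
  rw [Finset.filter_image, Finset.card_image_of_injOn]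
  exact hT.injOn_fst.mono (Finset.coe_subset.2 (Finset.filter_subset _ _))

theorem blockDegree_eq_two_mul (hT : SignedSystem T) {S : Finset V} (hS : S.card = 4) :
    blockDegree (T.image Prod.fst) S = 2 * (T.filter fun p => S ⊆ p.1 ∧ ¬ p.2 ⊆ S).card := by
  rw [hT.blockDegree_eq, ← Finset.card_filter_add_card_filter_not (fun p => p.2 ⊆ S),
    Finset.filter_filter, Finset.filter_filter, hT.balance S hS, two_mul]

theorem even_blockDegree (hT : SignedSystem T) {S : Finset V} (hS : S.card = 4) :
    Even (blockDegree (T.image Prod.fst) S) :=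
  ⟨_, (hT.blockDegree_eq_two_mul hS).trans (two_mul _)⟩

/-- Two blocks share at least two points, because the signs of disjoint faces have to agree at one
common point and to differ at another. -/
theorem two_le_card_inter (hT : SignedSystem T) {B C : Finset V} (hB : B ∈ T.image Prod.fst)
    (hC : C ∈ T.image Prod.fst) (hne : B ≠ C) : 2 ≤ (B ∩ C).card := by
  obtain ⟨p, hp, rfl⟩ := Finset.mem_image.1 hB
  obtain ⟨q, hq, rfl⟩ := Finset.mem_image.1 hC
  obtain ⟨i, hi, j, hj, h1, h2⟩ := hT.conflict p hp q hq fun h => hne (by rw [h])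
  exact Finset.one_lt_card.2 ⟨i, hi, j, hj, fun h => h2 (h ▸ h1)⟩

/-- If each 4-set lies in at most two blocks, then the number of blocks of a subfamily that covers
each 4-set an even number of times is divisible by 4. Indeed, each 4-set covered by the subfamily
is covered by exactly two of its blocks, which give it opposite signs; as there are evenly many
negative signs in each block, the number of covered 4-sets is even. -/
theorem four_dvd_card_of_even (hT : SignedSystem T)
    (h2 : ∀ S : Finset V, S.card = 4 → blockDegree (T.image Prod.fst) S ≤ 2)
    {P : Finset (Finset V)} (hP : P ⊆ T.image Prod.fst)
    (hev : ∀ S : Finset V, S.card = 4 → Even (blockDegree P S)) : 4 ∣ P.card := by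
  set K := P.biUnion (Finset.powersetCard 4) with hK
  have hK4 : ∀ S ∈ K, S.card = 4 := by
    intro S hS
    obtain ⟨B, -, hB⟩ := Finset.mem_biUnion.1 hS
    exact (Finset.mem_powersetCard.1 hB).2
  have hdeg : ∀ S ∈ K, blockDegree P S = 2 := by
    intro S hS
    have h4 := hK4 S hS
    obtain ⟨B, hBP, hB⟩ := Finset.mem_biUnion.1 hS
    have hpos := blockDegree_pos.2 ⟨B, hBP, (Finset.mem_powersetCard.1 hB).1⟩
    have hle := (blockDegree_mono hP S).trans (h2 S h4)
    obtain ⟨r, hr⟩ := hev S h4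
    omega
  have h5 : ∀ B ∈ P, B.card = 5 := fun B hB => hT.card_of_mem_blocks (hP hB)
  have hsum := sum_blockDegree h5
  rw [Finset.sum_congr rfl hdeg, Finset.sum_const, smul_eq_mul] at hsum
  -- the signed blocks over `P`
  set R := T.filter fun p => p.1 ∈ P with hR
  have hcount : ∑ S ∈ K, (R.filter fun p => S ⊆ p.1 ∧ ¬ p.2 ⊆ S).card = K.card := by
    rw [Finset.card_eq_sum_ones]
    refine Finset.sum_congr rfl fun S hS => ?_
    have h4 := hK4 S hS
    have h := hT.blockDegree_eq_two_mul h4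
    have hle := h2 S h4
    have hge := blockDegree_mono hP S
    rw [hdeg S hS] at hge
    have hTP : (T.image Prod.fst).filter (fun B => S ⊆ B) = P.filter (fun B => S ⊆ B) := by
      refine (Finset.eq_of_subset_of_card_le (Finset.filter_subset_filter _ hP) ?_).symm
      have := hdeg S hS
      unfold blockDegree at this hle
      omega
    have : R.filter (fun p => S ⊆ p.1 ∧ ¬ p.2 ⊆ S) = T.filter (fun p => S ⊆ p.1 ∧ ¬ p.2 ⊆ S) := by
      ext p
      simp only [hR, Finset.mem_filter]
      constructor
      · rintro ⟨⟨h1, -⟩, h2⟩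
        exact ⟨h1, h2⟩
      · rintro ⟨h1, h2⟩
        refine ⟨⟨h1, ?_⟩, h2⟩
        have : p.1 ∈ (T.image Prod.fst).filter (fun B => S ⊆ B) :=
          Finset.mem_filter.2 ⟨Finset.mem_image_of_mem _ h1, h2.1⟩
        rw [hTP] at this
        exact (Finset.mem_filter.1 this).1
    rw [this]
    omega
  have hswap := Finset.sum_card_bipartiteAbove_eq_sum_card_bipartiteBelow
    (s := K) (t := R) (fun S p => S ⊆ p.1 ∧ ¬ p.2 ⊆ S)
  unfold Finset.bipartiteAbove Finset.bipartiteBelow at hswap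
  have hrow : ∀ p ∈ R, (K.filter fun S => S ⊆ p.1 ∧ ¬ p.2 ⊆ S).card = p.2.card := by
    intro p hp
    obtain ⟨hpT, hpP⟩ := Finset.mem_filter.1 hp
    have h5p := hT.card_block p hpT
    have hsub := hT.subset p hpT
    have : (K.filter fun S => S ⊆ p.1 ∧ ¬ p.2 ⊆ S) = p.2.image p.1.erase := by
      ext S
      simp only [Finset.mem_filter, Finset.mem_image]
      constructor
      · rintro ⟨hS, h1, h2⟩
        have : S ∈ p.1.image p.1.erase := by
          rw [← powersetCard_eq_image_erase h5p]
          exact Finset.mem_powersetCard.2 ⟨h1, hK4 S hS⟩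
        obtain ⟨i, hi, rfl⟩ := Finset.mem_image.1 this
        refine ⟨i, ?_, rfl⟩
        by_contra hc
        exact h2 fun x hx => Finset.mem_erase.2 ⟨fun h => hc (h ▸ hx), hsub hx⟩
      · rintro ⟨i, hi, rfl⟩
        refine ⟨Finset.mem_biUnion.2 ⟨p.1, hpP, ?_⟩, Finset.erase_subset _ _, fun h => ?_⟩
        · rw [powersetCard_eq_image_erase h5p]
          exact Finset.mem_image_of_mem _ (hsub hi)
        · exact Finset.notMem_erase i p.1 (h hi)
    rw [this, Finset.card_image_of_injOn]
    exact (Finset.erase_injOn p.1).mono (by exact_mod_cast hsub)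
  rw [hcount, Finset.sum_congr rfl hrow] at hswap
  have heven : Even K.card := by
    rw [hswap]
    exact Finset.even_sum _ fun p hp => hT.even p (Finset.mem_filter.1 hp).1
  obtain ⟨r, hr⟩ := heven
  omega

/-- If each 4-set lies in at most two blocks, then exactly 40 of them are covered by blocks. -/
theorem card_biUnion_powersetCard (hT : SignedSystem T)
    (h2 : ∀ S : Finset V, S.card = 4 → blockDegree (T.image Prod.fst) S ≤ 2) :
    ((T.image Prod.fst).biUnion (Finset.powersetCard 4)).card = 40 := by
  have hsum := sum_blockDegree fun B hB => hT.card_of_mem_blocks hB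
  rw [hT.card_blocks, Finset.sum_congr rfl (g := fun _ => 2), Finset.sum_const,
    smul_eq_mul] at hsum
  · omega
  · intro S hS
    obtain ⟨B, hBP, hB⟩ := Finset.mem_biUnion.1 hS
    obtain ⟨hSB, h4⟩ := Finset.mem_powersetCard.1 hB
    have hpos := blockDegree_pos.2 ⟨B, hBP, hSB⟩
    have hle := h2 S h4
    obtain ⟨r, hr⟩ := hT.even_blockDegree h4
    omega

end SignedSystem

end

/-! ### Relabelling and switching of signed systems -/

/-- The image of a signed block under an injection of the point set. -/
def mapPair {V W : Type*} (f : V ↪ W) (p : Finset V × Finset V) : Finset W × Finset W :=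
  (p.1.map f, p.2.map f)

theorem mapPair_injective {V W : Type*} (f : V ↪ W) : Function.Injective (mapPair f) := by
  rintro ⟨a, b⟩ ⟨c, d⟩ h
  simp only [mapPair, Prod.mk.injEq, Finset.map_inj] at h
  exact Prod.ext h.1 h.2

section

variable {V W : Type*} [DecidableEq V] [DecidableEq W]

theorem SignedSystem.map {T : Finset (Finset V × Finset V)} (hT : SignedSystem T) (f : V ↪ W) :
    SignedSystem (T.image (mapPair f)) where
  card_eq := by rw [Finset.card_image_of_injective _ (mapPair_injective f), hT.card_eq]
  card_block := by
    simp only [Finset.forall_mem_image, mapPair, Finset.card_map]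
    exact fun p hp => hT.card_block p hp
  subset := by
    simp only [Finset.forall_mem_image, mapPair, Finset.map_subset_map]
    exact fun p hp => hT.subset p hp
  even := by
    simp only [Finset.forall_mem_image, mapPair, Finset.card_map]
    exact fun p hp => hT.even p hp
  eq_of_fst := by
    simp only [Finset.forall_mem_image]
    intro p hp q hq h
    rw [hT.eq_of_fst p hp q hq (Finset.map_inj.1 h)]
  conflict := by
    simp only [Finset.forall_mem_image]
    intro p hp q hq h
    obtain ⟨i, hi, j, hj, h1, h2⟩ := hT.conflict p hp q hq fun e => h (by rw [e])
    simp only [mapPair, ← Finset.map_inter]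
    refine ⟨f i, Finset.mem_map_of_mem f hi, f j, Finset.mem_map_of_mem f hj, ?_⟩
    simp only [Finset.mem_map']
    exact ⟨h1, h2⟩
  balance := by
    intro S hS
    rw [Finset.filter_image, Finset.filter_image,
      Finset.card_image_of_injective _ (mapPair_injective f),
      Finset.card_image_of_injective _ (mapPair_injective f)]
    by_cases hex : ∃ S', S = Finset.map f S'
    · obtain ⟨S', rfl⟩ := hex
      simp only [mapPair, Finset.map_subset_map]
      exact hT.balance S' (by simpa using hS)
    · have hno : ∀ p : Finset V × Finset V, ¬ S ⊆ (mapPair f p).1 := by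
        intro p hp
        obtain ⟨u, -, hu⟩ := Finset.subset_map_iff.1 hp
        exact hex ⟨u, hu⟩
      simp [hno]

theorem image_fst_image_mapPair (T : Finset (Finset V × Finset V)) (f : V ↪ W) :
    (T.image (mapPair f)).image Prod.fst =
      (T.image Prod.fst).map (Finset.mapEmbedding f).toEmbedding := by
  rw [Finset.map_eq_image, Finset.image_image, Finset.image_image]
  rfl

/-- Switching of a signed block with respect to a set `G` of points: in the two faces, the
coordinates in `G` are inverted; the representative of even size is chosen afterwards. -/
def switchPair (G : Finset V) (p : Finset V × Finset V) : Finset V × Finset V :=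
  (p.1, if Even (p.1 ∩ G).card then symmDiff p.2 (p.1 ∩ G) else p.1 \ symmDiff p.2 (p.1 ∩ G))

theorem mem_switchPair {G : Finset V} {p : Finset V × Finset V} {i : V} (hi : i ∈ p.1) :
    i ∈ (switchPair G p).2 ↔
      ((i ∈ p.2 ↔ i ∈ G) ↔ ¬ Even (p.1 ∩ G).card) := by
  unfold switchPair
  by_cases h : Even (p.1 ∩ G).card <;>
  by_cases h1 : i ∈ p.2 <;> by_cases h2 : i ∈ G <;>
  simp [h, h1, h2, hi, Finset.mem_symmDiff]

theorem switchPair_fst_eq {G : Finset V} {p q : Finset V × Finset V}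
    (h : switchPair G p = switchPair G q) : p.1 = q.1 := by
  have : (switchPair G p).1 = (switchPair G q).1 := by rw [h]
  exact this

theorem even_card_symmDiff (a b : Finset V) :
    Even (symmDiff a b).card ↔ (Even a.card ↔ Even b.card) := by
  have h1 := Finset.card_sdiff_add_card_inter a b
  have h2 := Finset.card_sdiff_add_card_inter b a
  have h3 : (symmDiff a b).card = (a \ b).card + (b \ a).card := by
    rw [symmDiff_def, Finset.sup_eq_union, Finset.card_union_of_disjoint disjoint_sdiff_sdiff]
  rw [Finset.inter_comm b a] at h2
  rw [h3, ← h1, ← h2]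
  simp only [Nat.even_add]
  tauto

theorem SignedSystem.switch {T : Finset (Finset V × Finset V)} (hT : SignedSystem T)
    (G : Finset V) : SignedSystem (T.image (switchPair G)) where
  card_eq := by
    rw [Finset.card_image_of_injOn, hT.card_eq]
    intro p hp q hq h
    exact hT.eq_of_fst p hp q hq (switchPair_fst_eq h)
  card_block := by
    simp only [Finset.forall_mem_image]
    exact fun p hp => hT.card_block p hp
  subset := by
    simp only [Finset.forall_mem_image]
    intro p hp
    have h := hT.subset p hp
    unfold switchPair
    dsimp only
    split_ifs
    · intro x hx
      rcases Finset.mem_symmDiff.1 hx with hx | hx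
      · exact h hx.1
      · exact (Finset.mem_inter.1 hx.1).1
    · exact Finset.sdiff_subset
  even := by
    simp only [Finset.forall_mem_image]
    intro p hp
    have h := hT.subset p hp
    have he := hT.even p hp
    have hs : symmDiff p.2 (p.1 ∩ G) ⊆ p.1 := by
      intro x hx
      rcases Finset.mem_symmDiff.1 hx with hx | hx
      · exact h hx.1
      · exact (Finset.mem_inter.1 hx.1).1
    have hev := even_card_symmDiff p.2 (p.1 ∩ G)
    unfold switchPair
    dsimp only
    split_ifs with hG
    · exact hev.2 ⟨fun _ => hG, fun _ => he⟩
    · rw [Finset.card_sdiff_of_subset hs, hT.card_block p hp,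
        Nat.even_sub (by rw [← hT.card_block p hp]; exact Finset.card_le_card hs), hev]
      have : ¬ Even 5 := by decide
      tauto
  eq_of_fst := by
    simp only [Finset.forall_mem_image]
    intro p hp q hq h
    rw [hT.eq_of_fst p hp q hq h]
  conflict := by
    simp only [Finset.forall_mem_image]
    intro p hp q hq h
    obtain ⟨i, hi, j, hj, h1, h2⟩ := hT.conflict p hp q hq fun e => h (by rw [e])
    have hxor : ∀ a b g c d : Prop, (((a ↔ g) ↔ ¬ c) ↔ ((b ↔ g) ↔ ¬ d)) ↔
        ((a ↔ b) ↔ (c ↔ d)) := by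
      intro a b g c d
      by_cases a <;> by_cases b <;> by_cases g <;> by_cases c <;> by_cases d <;> simp [*]
    have e1 : ∀ i ∈ p.1 ∩ q.1, (i ∈ (switchPair G p).2 ↔ i ∈ (switchPair G q).2) ↔
        ((i ∈ p.2 ↔ i ∈ q.2) ↔ (Even (p.1 ∩ G).card ↔ Even (q.1 ∩ G).card)) := by
      intro i hi
      rw [Finset.mem_inter] at hi
      rw [mem_switchPair hi.1, mem_switchPair hi.2, hxor]
    by_cases hG : Even (p.1 ∩ G).card ↔ Even (q.1 ∩ G).card
    · exact ⟨i, hi, j, hj, (e1 i hi).2 (iff_of_true h1 hG),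
        fun h => h2 (((e1 j hj).1 h).2 hG)⟩
    · exact ⟨j, hj, i, hi, (e1 j hj).2 (iff_of_false h2 hG),
        fun h => hG (((e1 i hi).1 h).1 h1)⟩
  balance := by
    intro S hS
    have hinj : Set.InjOn (switchPair G) (T : Set (Finset V × Finset V)) := fun p hp q hq h =>
      hT.eq_of_fst p hp q hq (switchPair_fst_eq h)
    rw [Finset.filter_image, Finset.filter_image,
      Finset.card_image_of_injOn (hinj.mono (Finset.coe_subset.2 (Finset.filter_subset _ _))),
      Finset.card_image_of_injOn (hinj.mono (Finset.coe_subset.2 (Finset.filter_subset _ _)))]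
    -- for `B = insert v S`, switching preserves or inverts the sign of `v` according to the
    -- parity of `|S ∩ G|`
    have key : ∀ p ∈ T, S ⊆ p.1 →
        ((switchPair G p).2 ⊆ S ↔ (p.2 ⊆ S ↔ Even (S ∩ G).card)) := by
      intro p hp hSp
      obtain ⟨v, hvS, hp1⟩ := exists_eq_insert_of_subset hSp (by rw [hS, hT.card_block p hp])
      have hvp : v ∈ p.1 ∧ v ∉ S := ⟨by rw [hp1]; exact Finset.mem_insert_self v S, hvS⟩
      have hsub : ∀ N ⊆ p.1, (N ⊆ S ↔ v ∉ N) := by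
        intro N hN
        constructor
        · exact fun h hvN => hvp.2 (h hvN)
        · intro h x hx
          have := hN hx
          rw [hp1, Finset.mem_insert] at this
          rcases this with rfl | h'
          · exact absurd hx h
          · exact h'
      have hN' : (switchPair G p).2 ⊆ p.1 := by
        unfold switchPair
        dsimp only
        split_ifs
        · intro x hx
          rcases Finset.mem_symmDiff.1 hx with hx | hx
          · exact hT.subset p hp hx.1
          · exact (Finset.mem_inter.1 hx.1).1
        · exact Finset.sdiff_subset
      rw [hsub _ hN', hsub _ (hT.subset p hp), mem_switchPair hvp.1]
      have hpar : Even (p.1 ∩ G).card ↔ (Even (S ∩ G).card ↔ v ∉ G) := by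
        rw [hp1]
        by_cases hvG : v ∈ G
        · rw [Finset.insert_inter_of_mem hvG, Finset.card_insert_of_notMem
            (fun h => hvp.2 (Finset.mem_inter.1 h).1), Nat.even_add_one]
          simp [hvG]
        · rw [Finset.insert_inter_of_notMem hvG]
          simp [hvG]
      rw [hpar]
      by_cases v ∈ p.2 <;> by_cases v ∈ G <;> by_cases Even (S ∩ G).card <;> simp [*]
    have hbal := hT.balance S hS
    by_cases hG : Even (S ∩ G).card
    · convert hbal using 2 <;> refine Finset.filter_congr fun p hp => ?_
      · refine and_congr_right fun h => ?_
        rw [key p hp h]; simp [hG]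
      · refine and_congr_right fun h => ?_
        rw [key p hp h]; simp [hG]
    · convert hbal.symm using 2 <;> refine Finset.filter_congr fun p hp => ?_
      · refine and_congr_right fun h => ?_
        rw [key p hp h]; simp [hG]
      · refine and_congr_right fun h => ?_
        rw [key p hp h]; simp [hG]

end

/-! ### Exhaustive search for the block system -/

/-- Evaluation of the argument `n` before it is passed to `k`; semantically just `k n`. The kernel
reduces lazily, and without this numbers would be passed on as unevaluated expressions. -/
def evalNat {α : Type} (n : ℕ) (k : ℕ → α) : α :=
  match n with
  | 0 => k 0
  | Nat.succ m => k (Nat.succ m)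

theorem evalNat_eq {α : Type} (n : ℕ) (k : ℕ → α) : evalNat n k = k n := by
  cases n <;> rfl

/-- The sum of those entries of `l` whose index is the position of a one of `e`: if the `k`-th
entry of `l` is `2 ^ c k`, this is the mask of the image under `c` of the set with mask `e`. -/
def relabelMask : List ℕ → ℕ → ℕ
  | [], _ => 0
  | p :: l, e => Nat.add (Nat.mul p (Nat.land e 1)) (relabelMask l (Nat.shiftRight e 1))

/-- The masks of the blocks of `unitradeE`. -/
def masksE : List ℕ :=
  [55, 59, 61, 62, 87, 91, 93, 94, 103, 107, 109, 174, 206, 230, 234, 236]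

/-- The masks of the blocks of `unitradeF`. -/
def masksF : List ℕ :=
  [87, 91, 93, 94, 103, 107, 109, 110, 167, 171, 173, 174, 151, 155, 157, 158]

/-- Whether `l` is a rearrangement of `2 ^ 0, …, 2 ^ 7` such that relabelling by `l` sends all
masks in `ms` into `bl`. -/
def isRelabelling (ms bl l : List ℕ) : Bool :=
  Nat.beq l.length 8 && [1, 2, 4, 8, 16, 32, 64, 128].all (fun p => l.any (Nat.beq p)) &&
    ms.all fun e => evalNat (relabelMask l e) fun b => bl.any (Nat.beq b)

/-- The points, written as powers of two, that lie in exactly `d` of the blocks `bl`. -/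
def pointsOfDegree (bl pts : List ℕ) (d : ℕ) : List ℕ :=
  pts.filter fun p => Nat.beq d (bl.foldr (fun b k => bif Nat.beq (Nat.land b p) 0 then k
    else Nat.succ k) 0)

/-- A sufficient test for `bl` being a copy of `E` or `F`. The points are matched by their degrees;
in `E`, the points of equal degree are interchangeable, and in `F`, the four points of degree 8
form two pairs that are not covered by a block. -/
def isEOrF (bl pts : List ℕ) : Bool :=
  isRelabelling masksE bl ([9, 12, 8, 11, 5].flatMap (pointsOfDegree bl pts)) ||
  match pointsOfDegree bl pts 8 with
  | [w, x, y, z] =>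
    let l := pointsOfDegree bl pts 12
    isRelabelling masksF bl (l ++ [w, x, y, z]) || isRelabelling masksF bl (l ++ [w, y, x, z]) ||
      isRelabelling masksF bl (l ++ [w, z, x, y])
  | _ => false

/-- The set, as a bit set of masks, of the 4-subsets of the block `B`, given one of them, `S`, and
the list `es` of the elements of `S` as powers of two. -/
def facetSet (S B : ℕ) (es : List ℕ) : ℕ :=
  es.foldr (fun e F => Nat.lor F (Nat.pow 2 (Nat.sub B e))) (Nat.pow 2 S)

/-- The number of the `e` in `es` for which `B - e` belongs to the bit set `op`. -/
def openCount (op B : ℕ) (es : List ℕ) : ℕ :=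
  es.foldr (fun e k => Nat.add k (Nat.land (Nat.shiftRight op (Nat.sub B e)) 1)) 0

/-- The first entry of the list that belongs to the bit set `op`, with the rest of the list. -/
def findOpen (op : ℕ) : List ℕ → Option (ℕ × List ℕ)
  | [] => none
  | S :: l => bif Nat.testBit op S then some (S, l) else findOpen op l

/-- The search step that adds the block `S + p` to `bl`, unless this is impossible because
it contains a 4-set that lies in two blocks already, or more than 40 4-sets would be covered, or
it has fewer than two points in common with a block. -/
def tryBlock (next : List ℕ → List ℕ → ℕ → ℕ → ℕ → ℕ → Bool) (bl st es : List ℕ)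
    (m op cl u S p : ℕ) : Bool :=
  evalNat (Nat.add S p) fun B =>
  evalNat (facetSet S B es) fun F =>
  bif Nat.beq (Nat.land cl F) 0 then
    evalNat (Nat.sub (Nat.add u 4) (openCount op B es)) fun u' =>
    bif Nat.ble u' 40 then
      bif bl.all (fun b => evalNat (Nat.land b B) fun x =>
          !Nat.beq (Nat.land x (Nat.sub x 1)) 0) then
        evalNat (Nat.xor op F) fun op' =>
        evalNat (Nat.lor cl (Nat.land op F)) fun cl' =>
        next (B :: bl) (es.foldr (fun e l => Nat.sub B e :: l) (S :: st)) (Nat.succ m) op' cl' u'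
      else true
    else true
  else true

/-- Depth-first search for families of 16 blocks of size 5 that cover each 4-set zero times or
twice. Points are represented by powers of two: `pts` are those in use, `new` is the next one.
`bl` is the list of the `m` blocks chosen so far, `op` and `cl` are the bit sets of the 4-sets
contained in exactly one and in exactly two of them, `u` is the number of 4-sets contained in at
least one of them, and `st` is a list of 4-sets in which to look for the one to be completed next.
The value `true` means that each family containing `bl` is a copy of `E` or `F`. -/
def blockSearch : ℕ → List ℕ → ℕ → List ℕ → List ℕ → ℕ → ℕ → ℕ → ℕ → Bool
  | 0, _, _, _, _, _, _, _, _ => false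
  | fuel + 1, pts, new, bl, st, m, op, cl, u =>
    bif Nat.beq op 0 then
      bif Nat.beq m 16 then isEOrF bl pts else Nat.ble 11 m || !Nat.beq (Nat.mod m 4) 0
    else
      match findOpen op st with
      | none => false
      | some (S, st') =>
        let es := pts.filter fun p => !Nat.beq (Nat.land S p) 0
        pts.all (fun p => bif Nat.beq (Nat.land S p) 0 then
            tryBlock (blockSearch fuel pts new) bl st' es m op cl u S p else true) &&
          tryBlock (blockSearch fuel (new :: pts) (Nat.mul 2 new)) bl st' es m op cl u S new

/-- Each family containing the block `{0, 1, 2, 3, 4}` is a copy of `E` or `F`. -/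
theorem blockSearch_eq_true :
    blockSearch 17 [1, 2, 4, 8, 16] 32 [31] [30, 29, 27, 23, 15] 1
      (2 ^ 30 + 2 ^ 29 + 2 ^ 27 + 2 ^ 23 + 2 ^ 15) 0 5 = true := by
  decide +kernel

theorem UnitradeEquiv.trans_map {V W X : Type*} {A : Finset (Finset V)} {U : Finset (Finset W)}
    (g : W ↪ X) (h : UnitradeEquiv A U) :
    UnitradeEquiv A (U.map (Finset.mapEmbedding g).toEmbedding) := by
  obtain ⟨f, rfl⟩ := h
  refine ⟨f.trans g, ?_⟩
  ext B
  simp [Finset.mem_map, Finset.map_map]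

theorem mem_bits_relabelMask (cs : List ℕ) (hcs : cs.Nodup) (e i : ℕ) :
    i ∈ bits (relabelMask (cs.map (2 ^ ·)) e) ↔ ∃ k, cs[k]? = some i ∧ e.testBit k = true := by
  induction cs generalizing e i with
  | nil => simp [relabelMask, bits_zero]
  | cons c cs ih =>
    rw [List.nodup_cons] at hcs
    have ih' := ih hcs.2 (Nat.shiftRight e 1)
    have hshift : ∀ k, (Nat.shiftRight e 1).testBit k = e.testBit (k + 1) := by
      intro k
      change (e >>> 1).testBit k = _
      rw [Nat.testBit_shiftRight, add_comm]
    simp only [hshift] at ih'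
    have hc : c ∉ bits (relabelMask (cs.map (2 ^ ·)) (Nat.shiftRight e 1)) := by
      rw [ih']
      rintro ⟨k, hk, -⟩
      exact hcs.1 (List.mem_of_getElem? hk)
    have hsplit : (∃ k, (c :: cs)[k]? = some i ∧ e.testBit k = true) ↔
        (c = i ∧ e % 2 = 1) ∨ ∃ k, cs[k]? = some i ∧ e.testBit (k + 1) = true := by
      constructor
      · rintro ⟨_ | k, h1, h2⟩
        · left
          simpa [Nat.testBit_zero] using And.intro h1 h2
        · exact Or.inr ⟨k, by simpa using h1, h2⟩
      · rintro (⟨h1, h2⟩ | ⟨k, h1, h2⟩)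
        · exact ⟨0, by simpa using h1, by simpa [Nat.testBit_zero] using h2⟩
        · exact ⟨k + 1, by simpa using h1, h2⟩
    rw [hsplit, ← ih' i]
    have hval : relabelMask ((c :: cs).map (2 ^ ·)) e =
        relabelMask (cs.map (2 ^ ·)) (Nat.shiftRight e 1) + 2 ^ c * (e % 2) := by
      change 2 ^ c * (e &&& 1) + _ = _
      rw [Nat.and_one_is_mod, add_comm]
    rw [hval]
    rcases Nat.mod_two_eq_zero_or_one e with h | h
    · simp [h]
    · rw [h, mul_one, bits_add_two_pow hc, Finset.mem_insert]
      simp only [and_true, eq_comm]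

theorem exists_mem_masksE : ∀ u ∈ unitradeE, ∃ e ∈ masksE, ∀ k : Fin 8,
    k ∈ u ↔ Nat.testBit e k = true := by decide +kernel

theorem exists_mem_masksF : ∀ u ∈ unitradeF, ∃ e ∈ masksF, ∀ k : Fin 8,
    k ∈ u ↔ Nat.testBit e k = true := by decide +kernel

theorem lt_of_mem_masksE : ∀ e ∈ masksE, e < 2 ^ 8 := by decide
theorem lt_of_mem_masksF : ∀ e ∈ masksF, e < 2 ^ 8 := by decide

theorem card_unitradeE : unitradeE.card = 16 := by decide +kernel
theorem card_unitradeF : unitradeF.card = 16 := by decide +kernel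

/-- If `A` consists of the sets with masks in `ms`, a relabelling that sends `ms` into `bl` embeds
`A` into each family `U` containing `bl`. -/
theorem unitradeEquiv_of_isRelabelling {A : Finset (Finset (Fin 8))} {ms bl l : List ℕ}
    {U : Finset (Finset ℕ)} (hA : ∀ u ∈ A, ∃ e ∈ ms, ∀ k : Fin 8, k ∈ u ↔ Nat.testBit e k = true)
    (hms : ∀ e ∈ ms, e < 2 ^ 8) (hbl : ∀ b ∈ bl, bits b ∈ U) (hcard : U.card ≤ A.card)
    (h : isRelabelling ms bl l = true) : UnitradeEquiv A U := by
  simp only [isRelabelling, Bool.and_eq_true, Nat.beq_eq, List.all_eq_true,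
    List.any_eq_true, evalNat_eq] at h
  obtain ⟨⟨hlen, hall⟩, hrel⟩ := h
  set L : List ℕ := [1, 2, 4, 8, 16, 32, 64, 128] with hL
  have hsub : L ⊆ l := by
    intro p hp
    obtain ⟨q, hq, rfl⟩ := hall p hp
    exact hq
  have hperm : L.Perm l :=
    (List.subperm_of_subset (by decide) hsub).perm_of_length_le (by rw [hlen]; decide)
  obtain ⟨cs, hcs⟩ : ∃ cs : List ℕ, l = cs.map (2 ^ ·) := by
    refine ⟨l.map Nat.log2, ?_⟩
    rw [List.map_map]
    refine (List.map_id l).symm.trans (List.map_congr_left fun p hp => ?_)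
    have hpL : p ∈ L := hperm.mem_iff.2 hp
    have : ∀ p ∈ L, id p = ((2 ^ ·) ∘ Nat.log2) p := by decide
    exact this p hpL
  have hnd : cs.Nodup := by
    have : l.Nodup := hperm.nodup_iff.1 (by decide)
    rw [hcs] at this
    exact this.of_map _
  have hcslen : cs.length = 8 := by rw [← hlen, hcs, List.length_map]
  have hinj : Function.Injective fun k : Fin 8 => cs[k.1]'(by omega) := by
    intro a b hab
    exact Fin.ext ((hnd.getElem_inj_iff).1 hab)
  refine ⟨⟨_, hinj⟩, (Finset.eq_of_subset_of_card_le ?_ (by rwa [Finset.card_map])).symm⟩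
  intro B hB
  obtain ⟨u, hu, rfl⟩ := Finset.mem_map.1 hB
  obtain ⟨e, he, heu⟩ := hA u hu
  obtain ⟨b, hb, hbe⟩ := hrel e he
  convert hbl b hb using 1
  ext i
  rw [← hbe, hcs, mem_bits_relabelMask cs hnd]
  simp only [RelEmbedding.coe_toEmbedding, Finset.mapEmbedding_apply, Finset.mem_map,
    Function.Embedding.coeFn_mk]
  constructor
  · rintro ⟨k, hk, rfl⟩
    exact ⟨k, List.getElem?_eq_getElem _, (heu k).1 hk⟩
  · rintro ⟨k, hk, hek⟩
    have hk8 : k < 8 := by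
      by_contra hc
      have := Nat.testBit_lt_two_pow
        (lt_of_lt_of_le (hms e he) (Nat.pow_le_pow_right two_pos (not_lt.1 hc)))
      simp [this] at hek
    rw [List.getElem?_eq_getElem (by omega), Option.some_inj] at hk
    exact ⟨⟨k, hk8⟩, (heu ⟨k, hk8⟩).2 hek, hk⟩

theorem unitradeEquiv_of_isEOrF {bl pts : List ℕ} {U : Finset (Finset ℕ)}
    (hbl : ∀ b ∈ bl, bits b ∈ U) (hcard : U.card = 16) (h : isEOrF bl pts = true) :
    UnitradeEquiv unitradeE U ∨ UnitradeEquiv unitradeF U := by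
  unfold isEOrF at h
  rw [Bool.or_eq_true] at h
  rcases h with h | h
  · exact Or.inl (unitradeEquiv_of_isRelabelling exists_mem_masksE lt_of_mem_masksE hbl
      (by rw [hcard, card_unitradeE]) h)
  · right
    split at h
    · simp only [Bool.or_eq_true] at h
      rcases h with (h | h) | h <;>
      exact unitradeEquiv_of_isRelabelling exists_mem_masksF lt_of_mem_masksF hbl
        (by rw [hcard, card_unitradeF]) h
    · exact absurd h (by decide)

/-- The family of the blocks with masks in `bl`. -/
def blocksOf (bl : List ℕ) : Finset (Finset ℕ) := bl.toFinset.image bits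

theorem mem_blocksOf {bl : List ℕ} {B : Finset ℕ} : B ∈ blocksOf bl ↔ ∃ b ∈ bl, bits b = B := by
  simp [blocksOf]

theorem blocksOf_cons (b : ℕ) (bl : List ℕ) :
    blocksOf (b :: bl) = insert (bits b) (blocksOf bl) := by
  simp [blocksOf]

theorem card_blocksOf {bl : List ℕ} (h : bl.Nodup) : (blocksOf bl).card = bl.length := by
  rw [blocksOf, Finset.card_image_of_injective _ bits_injective, List.toFinset_card_of_nodup h]

/-- The state of `blockSearch` describes blocks on the points `0, …, n - 1` of the family `U`. -/
structure SearchInvariant (U : Finset (Finset ℕ)) (n : ℕ) (pts bl : List ℕ) (m op cl u : ℕ) :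
    Prop where
  pts : ∀ p, p ∈ pts ↔ ∃ i < n, p = 2 ^ i
  subset_range : ∀ b ∈ bl, bits b ⊆ Finset.range n
  mem : ∀ b ∈ bl, bits b ∈ U
  nodup : bl.Nodup
  length : bl.length = m
  op : ∀ S, op.testBit S = true ↔ (bits S).card = 4 ∧ Odd (blockDegree (blocksOf bl) (bits S))
  cl : ∀ S, cl.testBit S = true →
    (bits S).card = 4 ∧ 2 ≤ blockDegree (blocksOf bl) (bits S)
  le_covered : u ≤ ((blocksOf bl).biUnion (Finset.powersetCard 4)).card

theorem SearchInvariant.blocksOf_subset {U : Finset (Finset ℕ)} {n : ℕ} {pts bl : List ℕ}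
    {m op cl u : ℕ} (h : SearchInvariant U n pts bl m op cl u) : blocksOf bl ⊆ U := by
  intro B hB
  obtain ⟨b, hb, rfl⟩ := mem_blocksOf.1 hB
  exact h.mem b hb

theorem findOpen_eq_some {op : ℕ} {st : List ℕ} {S : ℕ} {st' : List ℕ}
    (h : findOpen op st = some (S, st')) : op.testBit S = true := by
  induction st with
  | nil => simp [findOpen] at h
  | cons a l ih =>
    unfold findOpen at h
    cases hb : op.testBit a with
    | true =>
      rw [hb] at h
      simp only [cond_true, Option.some.injEq, Prod.mk.injEq] at h
      rw [← h.1, hb]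
    | false =>
      rw [hb] at h
      exact ih h

theorem testBit_facetSet {S B : ℕ} {es : List ℕ} {k : ℕ} :
    (facetSet S B es).testBit k = true ↔ k = S ∨ ∃ e ∈ es, k = B - e := by
  induction es with
  | nil =>
    change (2 ^ S).testBit k = true ↔ _
    simp [Nat.testBit_two_pow, eq_comm]
  | cons e es ih =>
    change (facetSet S B es ||| 2 ^ (B - e)).testBit k = true ↔ _
    rw [Nat.testBit_or, Bool.or_eq_true, ih, Nat.testBit_two_pow, decide_eq_true_eq]
    simp only [List.mem_cons, exists_eq_or_imp]
    rw [or_assoc, @eq_comm _ (B - e) k, @or_comm (∃ e ∈ es, k = B - e)]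

theorem card_filter_le_openCount (op B : ℕ) (es : List ℕ) :
    (es.toFinset.filter fun e => op.testBit (B - e) = true).card ≤ openCount op B es := by
  induction es with
  | nil => simp
  | cons e es ih =>
    have h1 : openCount op B (e :: es) = openCount op B es + (op >>> (B - e) &&& 1) := rfl
    have h2 : (op >>> (B - e) &&& 1) = if op.testBit (B - e) = true then 1 else 0 := by
      rw [Nat.and_one_is_mod]
      have := Nat.mod_two_eq_one_iff_testBit_zero (x := op >>> (B - e))
      rw [Nat.testBit_shiftRight, add_zero] at this
      split_ifs with h
      · exact this.2 h
      · rcases Nat.mod_two_eq_zero_or_one (op >>> (B - e)) with h' | h'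
        · exact h'
        · exact absurd (this.1 h') h
    rw [List.toFinset_cons, Finset.filter_insert, h1, h2]
    split_ifs
    · exact (Finset.card_insert_le _ _).trans (by omega)
    · omega

/-- If `B = S + p` is a block of `U` that has not been found yet, then the search step that adds
it is carried out, and it preserves the invariant. -/
theorem exists_of_tryBlock {T : Finset (Finset ℕ × Finset ℕ)} (hT : SignedSystem T)
    (h2 : ∀ S : Finset ℕ, S.card = 4 → blockDegree (T.image Prod.fst) S ≤ 2)
    {n n' : ℕ} {pts pts' bl st es : List ℕ} {m op cl u S v : ℕ}
    (inv : SearchInvariant (T.image Prod.fst) n pts bl m op cl u) (hn : n ≤ n')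
    (hpts' : ∀ p, p ∈ pts' ↔ ∃ i < n', p = 2 ^ i) (hS : op.testBit S = true)
    (hes : ∀ e, e ∈ es ↔ ∃ i ∈ bits S, e = 2 ^ i) (hvS : v ∉ bits S) (hvn : v < n')
    (hB : insert v (bits S) ∈ T.image Prod.fst) (hBP : insert v (bits S) ∉ blocksOf bl)
    {next : List ℕ → List ℕ → ℕ → ℕ → ℕ → ℕ → Bool}
    (h : tryBlock next bl st es m op cl u S (2 ^ v) = true) :
    ∃ B st' op' cl' u', next (B :: bl) st' (m + 1) op' cl' u' = true ∧
      SearchInvariant (T.image Prod.fst) n' pts' (B :: bl) (m + 1) op' cl' u' := by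
  set U := T.image Prod.fst with hU
  set P := blocksOf bl with hP
  have hPU : P ⊆ U := inv.blocksOf_subset
  obtain ⟨hS4, hSodd⟩ := (inv.op S).1 hS
  have hbits : bits (Nat.add S (2 ^ v)) = insert v (bits S) := bits_add_two_pow hvS
  unfold tryBlock at h
  simp only [evalNat_eq] at h
  set B := Nat.add S (2 ^ v) with hBdef
  rw [← hbits] at hB hBP
  have hB5 : (bits B).card = 5 := hT.card_of_mem_blocks hB
  have hP' : blocksOf (B :: bl) = insert (bits B) P := blocksOf_cons B bl
  have hP'U : insert (bits B) P ⊆ U := Finset.insert_subset hB hPU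
  have hdeg := blockDegree_insert hBP
  -- the 4-subsets of `B`
  have hsub : ∀ e ∈ es, ∃ i ∈ bits S, e = 2 ^ i ∧ bits (B - e) = (bits B).erase i := by
    intro e he
    obtain ⟨i, hi, rfl⟩ := (hes e).1 he
    exact ⟨i, hi, rfl, bits_sub_two_pow (by rw [hbits]; exact Finset.mem_insert_of_mem hi)⟩
  have hF : ∀ k, (facetSet S B es).testBit k = true ↔ bits k ⊆ bits B ∧ (bits k).card = 4 := by
    intro k
    rw [testBit_facetSet]
    constructor
    · rintro (rfl | ⟨e, he, rfl⟩)
      · exact ⟨by rw [hbits]; exact Finset.subset_insert _ _, hS4⟩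
      · obtain ⟨i, hi, rfl, hb⟩ := hsub e he
        rw [hb, Finset.card_erase_of_mem (by rw [hbits]; exact Finset.mem_insert_of_mem hi), hB5]
        exact ⟨Finset.erase_subset _ _, rfl⟩
    · rintro ⟨hk, hk4⟩
      have hmem : bits k ∈ (bits B).image (bits B).erase := by
        rw [← powersetCard_eq_image_erase (k := 4) hB5]
        exact Finset.mem_powersetCard.2 ⟨hk, hk4⟩
      obtain ⟨i, hi, hik⟩ := Finset.mem_image.1 hmem
      rw [hbits, Finset.mem_insert] at hi
      rcases hi with rfl | hi
      · left
        apply bits_injective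
        rw [← hik, hbits, Finset.erase_insert hvS]
      · right
        refine ⟨2 ^ i, (hes _).2 ⟨i, hi, rfl⟩, bits_injective ?_⟩
        rw [← hik, bits_sub_two_pow (by rw [hbits]; exact Finset.mem_insert_of_mem hi)]
  -- a 4-subset of `B` lies in at most one block found earlier
  have hle1 : ∀ k, bits k ⊆ bits B → (bits k).card = 4 → blockDegree P (bits k) ≤ 1 := by
    intro k hk hk4
    have e1 := hdeg (bits k)
    rw [if_pos hk] at e1
    have e2 := (blockDegree_mono hP'U (bits k)).trans (h2 _ hk4)
    omega
  have hland : Nat.beq (Nat.land cl (facetSet S B es)) 0 = true := by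
    rw [Nat.beq_eq, ← bits_eq_empty, bits_land, Finset.eq_empty_iff_forall_notMem]
    intro k hk
    rw [Finset.mem_inter, mem_bits, mem_bits, hF] at hk
    have e1 := hle1 k hk.2.1 hk.2.2
    have e2 : 2 ≤ blockDegree P (bits k) := (inv.cl k hk.1).2
    omega
  -- the number of 4-sets covered by the blocks including `B`
  have hu' : u + 4 - openCount op B es ≤ ((insert (bits B) P).biUnion (Finset.powersetCard 4)).card
      := by
    set C := P.biUnion (Finset.powersetCard 4) with hC
    set J := es.toFinset.filter fun e => op.testBit (B - e) = true
    have hold : (Finset.powersetCard 4 (bits B)) ∩ C ⊆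
        insert (bits S) (J.image fun e => bits (B - e)) := by
      intro A hA
      obtain ⟨k, rfl⟩ := exists_bits_eq A
      rw [Finset.mem_inter, Finset.mem_powersetCard, ← hF k, testBit_facetSet] at hA
      obtain ⟨hk, hkC⟩ := hA
      rw [Finset.mem_insert, Finset.mem_image]
      rcases hk with rfl | ⟨e, he, rfl⟩
      · exact Or.inl rfl
      · refine Or.inr ⟨e, Finset.mem_filter.2 ⟨List.mem_toFinset.2 he, ?_⟩, rfl⟩
        have hk := (hF (B - e)).1 (testBit_facetSet.2 (Or.inr ⟨e, he, rfl⟩))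
        refine (inv.op _).2 ⟨hk.2, ?_⟩
        obtain ⟨D, hD, hDk⟩ := Finset.mem_biUnion.1 hkC
        have e1 := blockDegree_pos.2 ⟨D, hD, (Finset.mem_powersetCard.1 hDk).1⟩
        have e2 := hle1 _ hk.1 hk.2
        have : blockDegree P (bits (B - e)) = 1 := by omega
        rw [← hP, this]
        exact odd_one
    have e1 := Finset.card_le_card hold
    have e2 := Finset.card_insert_le (bits S) (J.image fun e => bits (B - e))
    have e3 : (J.image fun e => bits (B - e)).card ≤ J.card := Finset.card_image_le
    have e4 := card_filter_le_openCount op B es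
    have e5 : (Finset.powersetCard 4 (bits B)).card = 5 := by
      rw [Finset.card_powersetCard, hB5]; rfl
    have e6 := Finset.card_sdiff_add_card_inter (Finset.powersetCard 4 (bits B)) C
    have e7 := Finset.card_sdiff_add_card (Finset.powersetCard 4 (bits B)) C
    rw [Finset.biUnion_insert, ← hC]
    have e8 := inv.le_covered
    change _ ≤ C.card at e8
    change J.card ≤ _ at e4
    omega
  have hu40 : Nat.ble (Nat.sub (Nat.add u 4) (openCount op B es)) 40 = true := by
    rw [Nat.ble_eq]
    refine hu'.trans ?_
    rw [← hT.card_biUnion_powersetCard h2]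
    exact Finset.card_le_card (Finset.biUnion_subset_biUnion_of_subset_left _ hP'U)
  have hall : bl.all (fun b => !Nat.beq (Nat.land (Nat.land b B) (Nat.sub (Nat.land b B) 1)) 0)
      = true := by
    rw [List.all_eq_true]
    intro b hb
    have hbP : bits b ∈ P := mem_blocksOf.2 ⟨b, hb, rfl⟩
    have hne : bits b ≠ bits B := fun e => hBP (e ▸ hbP)
    have hint := hT.two_le_card_inter (hPU hbP) hB hne
    rw [← bits_land] at hint
    rw [Bool.not_eq_true', ← Bool.not_eq_true, Nat.beq_eq, land_sub_one_eq_zero]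
    omega
  rw [hland, cond_true, hu40, cond_true, hall, cond_true] at h
  refine ⟨B, _, _, _, _, h, hpts', ?_, ?_, ?_, ?_, ?_, ?_, ?_⟩
  · rw [List.forall_mem_cons]
    refine ⟨?_, fun b hb => (inv.subset_range b hb).trans (Finset.range_subset_range.2 hn)⟩
    rw [hbits, Finset.insert_subset_iff, Finset.mem_range]
    refine ⟨hvn, ?_⟩
    have hpos : 0 < blockDegree P (bits S) := hSodd.pos
    obtain ⟨D, hD, hSD⟩ := blockDegree_pos.1 hpos
    obtain ⟨b, hb, rfl⟩ := mem_blocksOf.1 hD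
    exact hSD.trans ((inv.subset_range b hb).trans (Finset.range_subset_range.2 hn))
  · rw [List.forall_mem_cons]
    exact ⟨hB, inv.mem⟩
  · rw [List.nodup_cons]
    exact ⟨fun hb => hBP (mem_blocksOf.2 ⟨B, hb, rfl⟩), inv.nodup⟩
  · rw [List.length_cons, inv.length]
  · intro k
    rw [hP', hdeg]
    rw [← mem_bits, bits_xor, Finset.mem_symmDiff, mem_bits, mem_bits, inv.op k, hF k, ← hP]
    by_cases hk4 : (bits k).card = 4
    · by_cases hk : bits k ⊆ bits B
      · simp [hk4, hk, Nat.odd_add_one]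
      · simp [hk4, hk]
    · simp [hk4]
  · intro k hk
    rw [← mem_bits, bits_lor, bits_land, Finset.mem_union, Finset.mem_inter, mem_bits, mem_bits,
      mem_bits] at hk
    rw [hP', hdeg]
    rcases hk with hk | ⟨hk, hkF⟩
    · obtain ⟨h4, h'⟩ := inv.cl k hk
      exact ⟨h4, le_add_right h'⟩
    · obtain ⟨h4, h'⟩ := (inv.op k).1 hk
      refine ⟨h4, ?_⟩
      rw [if_pos ((hF k).1 hkF).1]
      have : 0 < blockDegree P (bits k) := h'.pos
      omega
  · rw [hP']
    exact hu'

theorem map_swap_eq {A : Finset ℕ} {v n : ℕ} (hv : v ∉ A) (hn : n ∉ A) :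
    A.map (Equiv.swap v n).toEmbedding = A := by
  rw [Finset.map_eq_image]
  refine (Finset.image_congr fun x hx => ?_).trans Finset.image_id
  exact Equiv.swap_apply_of_ne_of_ne (fun h => hv (h ▸ hx)) (fun h => hn (h ▸ hx))

theorem SearchInvariant.congr {U U' : Finset (Finset ℕ)} {n : ℕ} {pts bl : List ℕ} {m op cl u : ℕ}
    (inv : SearchInvariant U n pts bl m op cl u) (h : ∀ b ∈ bl, bits b ∈ U') :
    SearchInvariant U' n pts bl m op cl u :=
  { inv with mem := h }

/-- Soundness of `blockSearch`. If a 4-set `S` lies in exactly one block so far, parity gives a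
further one; its fifth point is in use, or may be taken to be the next new one. -/
theorem unitradeEquiv_of_blockSearch
    (h2 : ∀ T : Finset (Finset ℕ × Finset ℕ), SignedSystem T → ∀ S : Finset ℕ, S.card = 4 →
      blockDegree (T.image Prod.fst) S ≤ 2)
    (fuel : ℕ) {T : Finset (Finset ℕ × Finset ℕ)} (hT : SignedSystem T)
    {n : ℕ} {pts bl st : List ℕ} {m op cl u : ℕ}
    (inv : SearchInvariant (T.image Prod.fst) n pts bl m op cl u)
    (h : blockSearch fuel pts (2 ^ n) bl st m op cl u = true) :
    UnitradeEquiv unitradeE (T.image Prod.fst) ∨ UnitradeEquiv unitradeF (T.image Prod.fst) := by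
  induction fuel generalizing T n pts bl st m op cl u with
  | zero => exact absurd h (by simp [blockSearch])
  | succ fuel ih =>
    have hsubset := inv.blocksOf_subset
    have hPcard : (blocksOf bl).card = m := (card_blocksOf inv.nodup).trans inv.length
    have hU16 := hT.card_blocks
    unfold blockSearch at h
    cases hop : Nat.beq op 0 with
    | true =>
      rw [hop, cond_true] at h
      rw [Nat.beq_eq] at hop
      have hev : ∀ S : Finset ℕ, S.card = 4 → Even (blockDegree (blocksOf bl) S) := by
        intro S hS
        obtain ⟨k, rfl⟩ := exists_bits_eq S
        rw [← Nat.not_odd_iff_even]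
        intro hodd
        have := (inv.op k).2 ⟨hS, hodd⟩
        rw [hop] at this
        simp at this
      cases h16 : Nat.beq m 16 with
      | true =>
        rw [h16, cond_true] at h
        exact unitradeEquiv_of_isEOrF inv.mem hU16 h
      | false =>
        exfalso
        rw [h16, cond_false, Bool.or_eq_true, Nat.ble_eq, Bool.not_eq_true', ← Bool.not_eq_true,
          Nat.beq_eq] at h
        rw [← Bool.not_eq_true, Nat.beq_eq] at h16
        rcases h with h | h
        · -- the complementary subfamily is nonempty and has at most five blocks
          have hc := Finset.card_sdiff_of_subset hsubset
          have hle := Finset.card_le_card hsubset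
          have h6 := six_le_card_of_even (Q := T.image Prod.fst \ blocksOf bl)
            (Finset.card_pos.1 (by omega))
            (fun B hB => hT.card_of_mem_blocks (Finset.mem_sdiff.1 hB).1) (fun S hS => by
              have e1 := blockDegree_sdiff hsubset S
              have e2 := hT.even_blockDegree hS
              rw [← e1, Nat.even_add] at e2
              exact e2.2 (hev S hS))
          omega
        · exact h (Nat.mod_eq_zero_of_dvd (hPcard ▸ hT.four_dvd_card_of_even (h2 T hT) hsubset hev))
    | false =>
      rw [hop, cond_false] at h
      split at h
      · exact absurd h (by decide)
      · rename_i S st' hfind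
        have hS := findOpen_eq_some hfind
        obtain ⟨hS4, hodd⟩ := (inv.op S).1 hS
        rw [Bool.and_eq_true, List.all_eq_true] at h
        obtain ⟨hold, hnew⟩ := h
        have hes : ∀ e, e ∈ pts.filter (fun p => !Nat.beq (Nat.land S p) 0) ↔
            ∃ i ∈ bits S, e = 2 ^ i := by
          have hSn : bits S ⊆ Finset.range n := by
            obtain ⟨D, hD, hSD⟩ := blockDegree_pos.1 hodd.pos
            obtain ⟨b, hb, rfl⟩ := mem_blocksOf.1 hD
            exact hSD.trans (inv.subset_range b hb)
          intro e
          rw [List.mem_filter, inv.pts, Bool.not_eq_true', ← Bool.not_eq_true, Nat.beq_eq,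
            ← bits_eq_empty, bits_land]
          constructor
          · rintro ⟨⟨i, -, rfl⟩, hi⟩
            rw [bits_two_pow, Finset.inter_singleton] at hi
            exact ⟨i, by_contra fun hc => hi (if_neg hc), rfl⟩
          · rintro ⟨i, hi, rfl⟩
            refine ⟨⟨i, Finset.mem_range.1 (hSn hi), rfl⟩, ?_⟩
            rw [bits_two_pow, Finset.inter_singleton, if_pos hi]
            exact Finset.singleton_ne_empty i
        have hSn : bits S ⊆ Finset.range n := by
          obtain ⟨D, hD, hSD⟩ := blockDegree_pos.1 hodd.pos
          obtain ⟨b, hb, rfl⟩ := mem_blocksOf.1 hD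
          exact hSD.trans (inv.subset_range b hb)
        -- by parity, there is a further block containing `S`
        obtain ⟨B, hB, hSB⟩ : ∃ B ∈ T.image Prod.fst \ blocksOf bl, bits S ⊆ B := by
          apply blockDegree_pos.1
          by_contra hc
          have e1 := blockDegree_sdiff hsubset (bits S)
          have e2 := hT.even_blockDegree hS4
          rw [← e1, Nat.eq_zero_of_not_pos hc, zero_add] at e2
          exact Nat.not_even_iff_odd.2 hodd e2
        rw [Finset.mem_sdiff] at hB
        obtain ⟨v, hvS, rfl⟩ := exists_eq_insert_of_subset hSB (by
          rw [hS4, hT.card_of_mem_blocks hB.1])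
        rcases lt_or_ge v n with hvn | hvn
        · have hstep := hold (2 ^ v) ((inv.pts _).2 ⟨v, hvn, rfl⟩)
          have hz : Nat.beq (Nat.land S (2 ^ v)) 0 = true := by
            rw [Nat.beq_eq, ← bits_eq_empty, bits_land, bits_two_pow, Finset.inter_singleton,
              if_neg hvS]
          rw [hz, cond_true] at hstep
          obtain ⟨B, st'', op', cl', u', hnext, inv'⟩ := exists_of_tryBlock hT (h2 T hT) inv
            le_rfl inv.pts hS hes hvS hvn hB.1 hB.2 hstep
          exact ih hT inv' hnext
        · -- exchange the point `v`, which has not been used yet, with the point `n`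
          set σ := (Equiv.swap v n).toEmbedding with hσ
          have hT' := hT.map σ
          have hblocks := image_fst_image_mapPair T σ
          have hfix : ∀ b ∈ bl, bits b ∈ (T.image (mapPair σ)).image Prod.fst := by
            intro b hb
            rw [hblocks, Finset.mem_map]
            refine ⟨bits b, inv.mem b hb, map_swap_eq (fun hc => ?_) (fun hc => ?_)⟩
            · exact absurd (Finset.mem_range.1 (inv.subset_range b hb hc)) (by omega)
            · exact absurd (Finset.mem_range.1 (inv.subset_range b hb hc)) (by omega)
          have hnS : n ∉ bits S := fun hc => lt_irrefl n (Finset.mem_range.1 (hSn hc))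
          have hB' : insert n (bits S) ∈ (T.image (mapPair σ)).image Prod.fst := by
            rw [hblocks, Finset.mem_map]
            refine ⟨_, hB.1, ?_⟩
            change (insert v (bits S)).map σ = _
            rw [Finset.map_insert, map_swap_eq hvS hnS, hσ, Equiv.coe_toEmbedding,
              Equiv.swap_apply_left]
          have hBP' : insert n (bits S) ∉ blocksOf bl := by
            intro hc
            obtain ⟨b, hb, hbe⟩ := mem_blocksOf.1 hc
            have := inv.subset_range b hb (hbe ▸ Finset.mem_insert_self n _)
            exact lt_irrefl n (Finset.mem_range.1 this)
          have hpts' : ∀ p, p ∈ 2 ^ n :: pts ↔ ∃ i < n + 1, p = 2 ^ i := by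
            intro p
            rw [List.mem_cons, inv.pts]
            constructor
            · rintro (rfl | ⟨i, hi, rfl⟩)
              · exact ⟨n, Nat.lt_succ_self n, rfl⟩
              · exact ⟨i, by omega, rfl⟩
            · rintro ⟨i, hi, rfl⟩
              rcases Nat.lt_succ_iff_lt_or_eq.1 hi with hi | rfl
              · exact Or.inr ⟨i, hi, rfl⟩
              · exact Or.inl rfl
          obtain ⟨B, st'', op', cl', u', hnext, inv'⟩ := exists_of_tryBlock hT' (h2 _ hT')
            (inv.congr hfix) (Nat.le_succ n) hpts' hS hes hnS (Nat.lt_succ_self n) hB' hBP' hnew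
          have hpow : Nat.mul 2 (2 ^ n) = 2 ^ (n + 1) := by
            rw [pow_succ, mul_comm]; rfl
          rw [hpow] at hnext
          have hback : T.image Prod.fst =
              ((T.image (mapPair σ)).image Prod.fst).map (Finset.mapEmbedding σ).toEmbedding := by
            have hσσ : σ.trans σ = Function.Embedding.refl ℕ := by
              ext x; simp [hσ]
            ext A
            simp [hblocks, Finset.mem_map, Finset.map_map, hσσ]
          rw [hback]
          exact (ih hT' inv' hnext).imp
            (UnitradeEquiv.trans_map σ) (UnitradeEquiv.trans_map σ)

/-! ### Exhaustive search for 4-sets in more than two blocks -/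

/-- `evalNat` for lists of pairs of numbers. -/
def evalPairs {α : Type} : List (ℕ × ℕ) → (List (ℕ × ℕ) → α) → α
  | [], k => k []
  | (a, b) :: l, k => evalNat a fun a => evalNat b fun b => evalPairs l fun l => k ((a, b) :: l)

/-- The masks of the subsets of the set with elements `es`, given as powers of two, whose size is
odd (for `q = true`) or even (for `q = false`). -/
def subsetMasks : List ℕ → Bool → List ℕ
  | [], true => []
  | [], false => [0]
  | e :: es, q => subsetMasks es q ++ (subsetMasks es (!q)).map (Nat.add e)

/-- `List.all` in terms of recursors, a form suited to evaluation by the kernel. -/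
def allPairs (l : List (ℕ × ℕ)) (f : ℕ × ℕ → Bool) : Bool :=
  List.rec true (fun a _ ih => Bool.rec false ih (f a)) l

/-- Whether the block with mask `B` differs from all blocks in `bl` and meets each of them in at
least two points. -/
def isNewBlock (bl : List (ℕ × ℕ)) (B : ℕ) : Bool :=
  allPairs bl fun b => !Nat.beq b.1 B && evalNat (Nat.land b.1 B) fun x =>
    !Nat.beq (Nat.land x (Nat.sub x 1)) 0

/-- Whether the signed block `(B, N)` is in conflict with all signed blocks in `bl`. -/
def isInConflict (bl : List (ℕ × ℕ)) (B N : ℕ) : Bool :=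
  allPairs bl fun b => evalNat (Nat.land b.1 B) fun x =>
    evalNat (Nat.land (Nat.xor b.2 N) x) fun d =>
    !Nat.beq d 0 && !Nat.beq d x

/-- The number of signed blocks in `bl` that contain `S` with positive sign. -/
def positiveDegree (bl : List (ℕ × ℕ)) (S : ℕ) : ℕ :=
  (bl.filter fun b => Nat.beq (Nat.land b.1 S) S && Nat.beq (Nat.land b.2 S) b.2).length

/-- The number of signed blocks in `bl` that contain `S` with negative sign. -/
def negativeDegree (bl : List (ℕ × ℕ)) (S : ℕ) : ℕ :=
  (bl.filter fun b => Nat.beq (Nat.land b.1 S) S && !Nat.beq (Nat.land b.2 S) b.2).length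

/-- The signed blocks `S + p`, with `p` in `pts` and of sign `q` on `S`, that may be added to
`bl`. -/
def signedBlocks (pts : List ℕ) (bl : List (ℕ × ℕ)) (S : ℕ) (q : Bool) : List (ℕ × ℕ) :=
  let gs := subsetMasks (pts.filter fun e => !Nat.beq (Nat.land S e) 0) q
  pts.flatMap fun p =>
    bif Nat.beq (Nat.land S p) 0 then
      evalNat (Nat.add S p) fun B =>
      bif isNewBlock bl B then
        gs.filterMap fun g => evalNat (bif q then Nat.add g p else g) fun N =>
          bif isInConflict bl B N then some (B, N) else none
      else []
    else []

/-- The signed blocks that may be added in order to reduce the difference of the numbers of positive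
and negative blocks containing `S`; `none` if there is no difference. -/
def completions (pts : List ℕ) (bl : List (ℕ × ℕ)) (S : ℕ) : Option (List (ℕ × ℕ)) :=
  evalNat (positiveDegree bl S) fun a => evalNat (negativeDegree bl S) fun b =>
    bif Nat.beq a b then none else some (signedBlocks pts bl S (Nat.ble b a))

/-- A short list among the lists `completions pts bl S`, where `S` runs through those entries of
`st` that satisfy `f`; it is compared with the list `cur` found before. -/
def bestCompletions (pts : List ℕ) (bl : List (ℕ × ℕ)) (f : ℕ → Bool) :
    List ℕ → Option (List (ℕ × ℕ)) → Option (List (ℕ × ℕ))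
  | [], cur => cur
  | S :: st, cur =>
    bif f S then
      match completions pts bl S with
      | none => bestCompletions pts bl f st cur
      | some c =>
        evalPairs c fun c =>
          bif Nat.ble c.length 2 then some c else
          match cur with
          | none => bestCompletions pts bl f st (some c)
          | some c' => bestCompletions pts bl f st
              (bif Nat.ble c'.length c.length then some c' else some c)
    else bestCompletions pts bl f st cur

/-- Depth-first search for signed systems. Points are represented by powers of two: `pts` are those
in use, `new` is the next one. `bl` are the `m` signed blocks chosen so far, and `st` is a list of
4-sets in which to look for the one to be completed next; those that belong to the bit set `op` are
preferred. The value `true` means that no signed system contains `bl`. -/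
def signedSearch : ℕ → List ℕ → ℕ → List (ℕ × ℕ) → List ℕ → ℕ → ℕ → Bool
  | 0, _, _, _, _, _, _ => false
  | fuel + 1, pts, new, bl, st, m, op =>
    match (match bestCompletions (new :: pts) bl (fun S => Nat.testBit op S) st none with
      | some c => some c
      | none => bestCompletions (new :: pts) bl (fun _ => true) st none) with
    | none => false
    | some c =>
      bif Nat.beq m 16 then true else
      c.all fun b =>
        let facets := ((new :: pts).filter fun e => !Nat.beq (Nat.land b.1 e) 0).map (Nat.sub b.1)
        evalNat (Nat.xor op (facets.foldr (fun S F => Nat.lor F (Nat.pow 2 S)) 0)) fun op' =>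
        bif Nat.ble new b.1 then
          signedSearch fuel (new :: pts) (Nat.mul 2 new) (b :: bl) (facets ++ st) (Nat.succ m) op'
        else signedSearch fuel pts new (b :: bl) (facets ++ st) (Nat.succ m) op'

/-- The 4-subsets of the five blocks `{0, 1, 2, 3, v}`, `v = 4, …, 7`, other than `{0, 1, 2, 3}`. -/
def startFacets : List ℕ :=
  [16, 32, 64, 128].flatMap fun p => [7 + p, 11 + p, 13 + p, 14 + p]

/-- No signed system contains the blocks `{0, 1, 2, 3, v}`, `v = 4, …, 7`, with negative signs at
the points of `∅`, `{0, 1}`, `{0, 6}` and `{1, 7}`, respectively. -/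
theorem signedSearch_eq_true₁ :
    signedSearch 13 [128, 64, 32, 16, 8, 4, 2, 1] 256 [(31, 0), (47, 3), (79, 65), (143, 130)]
      startFacets 4 (startFacets.foldr (fun S F => Nat.lor F (Nat.pow 2 S)) 0) = true := by
  decide +kernel

/-- The other start configuration, in which the last set is `{2, 7}`. -/
theorem signedSearch_eq_true₂ :
    signedSearch 13 [128, 64, 32, 16, 8, 4, 2, 1] 256 [(31, 0), (47, 3), (79, 65), (143, 132)]
      startFacets 4 (startFacets.foldr (fun S F => Nat.lor F (Nat.pow 2 S)) 0) = true := by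
  decide +kernel

theorem evalPairs_eq {α : Type} (l : List (ℕ × ℕ)) (k : List (ℕ × ℕ) → α) :
    evalPairs l k = k l := by
  induction l generalizing k with
  | nil => rfl
  | cons a l ih => simp only [evalPairs, evalNat_eq, ih]

theorem allPairs_eq_true {l : List (ℕ × ℕ)} {f : ℕ × ℕ → Bool} :
    allPairs l f = true ↔ ∀ b ∈ l, f b = true := by
  induction l with
  | nil => simp [allPairs]
  | cons a l ih =>
    have : allPairs (a :: l) f = Bool.rec false (allPairs l f) (f a) := rfl
    rw [this, List.forall_mem_cons, ← ih]
    cases f a <;> simp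

theorem mem_subsetMasks {es : List ℕ} (hes : ∀ e ∈ es, ∃ i, e = 2 ^ i) {N : Finset ℕ}
    (hN : ∀ i ∈ N, 2 ^ i ∈ es) (q : Bool) (hq : Odd N.card ↔ q = true) :
    ∃ g ∈ subsetMasks es q, bits g = N := by
  induction es generalizing N q with
  | nil =>
    obtain rfl : N = ∅ := Finset.eq_empty_of_forall_notMem fun i hi => by simpa using hN i hi
    cases q with
    | true => simp at hq
    | false => exact ⟨0, by simp [subsetMasks], bits_zero⟩
  | cons e es ih =>
    have ih' := fun {N} => ih (N := N) (fun e he => hes e (List.mem_cons_of_mem _ he))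
    obtain ⟨i, rfl⟩ := hes e List.mem_cons_self
    have hN' : ∀ j ∈ N, j ≠ i → 2 ^ j ∈ es := by
      intro j hj hji
      rcases List.mem_cons.1 (hN j hj) with h | h
      · exact absurd (Nat.pow_right_injective le_rfl h) hji
      · exact h
    simp only [subsetMasks, List.mem_append, List.mem_map]
    by_cases hi : i ∈ N
    · obtain ⟨g, hg, hgN⟩ := ih' (N := N.erase i)
        (fun j hj => hN' j (Finset.mem_of_mem_erase hj) (Finset.ne_of_mem_erase hj)) (!q) (by
          have := Finset.card_erase_add_one hi
          rw [← this, Nat.odd_add_one] at hq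
          rw [← not_iff_not, hq]
          simp)
      refine ⟨_, Or.inr ⟨g, hg, rfl⟩, ?_⟩
      have : Nat.add (2 ^ i) g = g + 2 ^ i := add_comm _ _
      rw [this, bits_add_two_pow (by rw [hgN]; exact Finset.notMem_erase i N), hgN,
        Finset.insert_erase hi]
    · obtain ⟨g, hg, hgN⟩ := ih' (fun j hj => hN' j hj fun h => hi (h ▸ hj)) q hq
      exact ⟨g, Or.inl hg, hgN⟩

/-- The signed block with the given masks. -/
def bitsPair (b : ℕ × ℕ) : Finset ℕ × Finset ℕ := (bits b.1, bits b.2)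

theorem bitsPair_injective : Function.Injective bitsPair := by
  rintro ⟨a, b⟩ ⟨c, d⟩ h
  simp only [bitsPair, Prod.mk.injEq] at h
  exact Prod.ext (bits_injective h.1) (bits_injective h.2)

/-- The state of `signedSearch` describes signed blocks of `T` on the points `0, …, n - 1`, and
4-sets of such points. -/
structure SignedInvariant (T : Finset (Finset ℕ × Finset ℕ)) (n : ℕ) (pts : List ℕ)
    (bl : List (ℕ × ℕ)) (st : List ℕ) (m : ℕ) : Prop where
  pts : ∀ p, p ∈ pts ↔ ∃ i < n, p = 2 ^ i
  mem : ∀ b ∈ bl, bitsPair b ∈ T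
  subset_range : ∀ b ∈ bl, bits b.1 ⊆ Finset.range n
  nodup : bl.Nodup
  length : bl.length = m
  card_eq : ∀ S ∈ st, (bits S).card = 4
  stack_subset : ∀ S ∈ st, bits S ⊆ Finset.range n

theorem land_beq_iff {a b : ℕ} : Nat.beq (Nat.land a b) b = true ↔ bits b ⊆ bits a := by
  rw [Nat.beq_eq, ← bits_injective.eq_iff, bits_land, Finset.inter_eq_right]

theorem land_beq_iff' {a b : ℕ} : Nat.beq (Nat.land a b) a = true ↔ bits a ⊆ bits b := by
  rw [Nat.beq_eq, ← bits_injective.eq_iff, bits_land, Finset.inter_eq_left]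

theorem land_beq_zero {a b : ℕ} : Nat.beq (Nat.land a b) 0 = true ↔ bits a ∩ bits b = ∅ := by
  rw [Nat.beq_eq, ← bits_eq_empty, bits_land]

theorem length_filter_eq_card {bl : List (ℕ × ℕ)} (h : bl.Nodup) (f : ℕ × ℕ → Bool)
    (p : Finset ℕ × Finset ℕ → Prop) [DecidablePred p] (hp : ∀ b, f b = true ↔ p (bitsPair b)) :
    (bl.filter f).length = ((bl.toFinset.image bitsPair).filter p).card := by
  rw [← List.toFinset_card_of_nodup (h.filter f), Finset.filter_image,
    Finset.card_image_of_injective _ bitsPair_injective, List.toFinset_filter]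
  congr 1
  ext b
  simp [hp]

theorem two_pow_mem_pts {n : ℕ} {pts : List ℕ} (hpts : ∀ p, p ∈ pts ↔ ∃ i < n, p = 2 ^ i) (p : ℕ) :
    p ∈ 2 ^ n :: pts ↔ ∃ i < n + 1, p = 2 ^ i := by
  rw [List.mem_cons, hpts]
  constructor
  · rintro (rfl | ⟨i, hi, rfl⟩)
    · exact ⟨n, Nat.lt_succ_self n, rfl⟩
    · exact ⟨i, by omega, rfl⟩
  · rintro ⟨i, hi, rfl⟩
    rcases Nat.lt_succ_iff_lt_or_eq.1 hi with hi | rfl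
    · exact Or.inr ⟨i, hi, rfl⟩
    · exact Or.inl rfl

/-- The masks of a block `insert v S` of `T` with sign `q` on `S` occur in `signedBlocks`. -/
theorem exists_mem_signedBlocks {T : Finset (Finset ℕ × Finset ℕ)} (hT : SignedSystem T)
    {n : ℕ} {pts : List ℕ} {bl : List (ℕ × ℕ)} {st : List ℕ} {m : ℕ}
    (inv : SignedInvariant T n pts bl st m) {S v : ℕ} (hS : bits S ⊆ Finset.range n)
    (hvS : v ∉ bits S) (hv : v < n + 1) {N : Finset ℕ} (hmem : (insert v (bits S), N) ∈ T)
    (hnot : (insert v (bits S), N) ∉ bl.toFinset.image bitsPair) (q : Bool)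
    (hq : v ∈ N ↔ q = true) :
    ∃ b ∈ signedBlocks (2 ^ n :: pts) bl S q, bitsPair b = (insert v (bits S), N) := by
  have hpts := two_pow_mem_pts inv.pts
  set es := (2 ^ n :: pts).filter fun e => !Nat.beq (Nat.land S e) 0 with hes
  have hmemes : ∀ i ∈ bits S, 2 ^ i ∈ es := by
    intro i hi
    rw [hes, List.mem_filter, hpts, Bool.not_eq_true', ← Bool.not_eq_true, land_beq_zero,
      bits_two_pow, Finset.inter_singleton, if_pos hi]
    exact ⟨⟨i, by have := Finset.mem_range.1 (hS hi); omega, rfl⟩, Finset.singleton_ne_empty i⟩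
  have hsub := hT.subset _ hmem
  have heven := hT.even _ hmem
  dsimp only at hsub heven
  have hNv : ∀ i ∈ N.erase v, i ∈ bits S := fun i hi =>
    (Finset.mem_insert.1 (hsub (Finset.mem_of_mem_erase hi))).resolve_left
      (Finset.ne_of_mem_erase hi)
  obtain ⟨g, hg, hgN⟩ := mem_subsetMasks (es := es)
    (fun e he => (by
      obtain ⟨i, -, h⟩ := (hpts e).1 (List.mem_filter.1 he).1
      exact ⟨i, h⟩)) (N := N.erase v) (fun i hi => hmemes i (hNv i hi)) q (by
      rw [← hq]
      by_cases hvN : v ∈ N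
      · have := Finset.card_erase_add_one hvN
        rw [← this, Nat.even_add_one, Nat.not_even_iff_odd] at heven
        exact iff_of_true heven hvN
      · rw [Finset.erase_eq_of_notMem hvN]
        exact iff_of_false (Nat.not_odd_iff_even.2 heven) hvN)
  have hvg : v ∉ bits g := by rw [hgN]; exact Finset.notMem_erase v N
  have hB : bits (Nat.add S (2 ^ v)) = insert v (bits S) := bits_add_two_pow hvS
  have hNm : bits (bif q then Nat.add g (2 ^ v) else g) = N := by
    cases q with
    | true =>
      have : bits (Nat.add g (2 ^ v)) = insert v (bits g) := bits_add_two_pow hvg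
      rw [cond_true, this, hgN, Finset.insert_erase (hq.2 rfl)]
    | false =>
      rw [cond_false, hgN, Finset.erase_eq_of_notMem (fun h => by simpa using hq.1 h)]
  refine ⟨(Nat.add S (2 ^ v), bif q then Nat.add g (2 ^ v) else g), ?_, by
    rw [bitsPair, hB, hNm]⟩
  have hne : ∀ b ∈ bl, bitsPair b ≠ (insert v (bits S), N) := fun b hb h =>
    hnot (Finset.mem_image.2 ⟨b, List.mem_toFinset.2 hb, h⟩)
  have hnew : isNewBlock bl (Nat.add S (2 ^ v)) = true := by
    rw [isNewBlock, allPairs_eq_true]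
    intro b hb
    have hne' : bits b.1 ≠ insert v (bits S) := fun h =>
      hne b hb (hT.eq_of_fst _ (inv.mem b hb) _ hmem h)
    have := hT.two_le_card_inter (Finset.mem_image_of_mem _ (inv.mem b hb))
      (Finset.mem_image_of_mem _ hmem) hne'
    rw [evalNat_eq, Bool.and_eq_true, Bool.not_eq_true', Bool.not_eq_true', ← Bool.not_eq_true,
      ← Bool.not_eq_true, Nat.beq_eq, Nat.beq_eq, land_sub_one_eq_zero, bits_land, hB]
    refine ⟨fun h => hne' (by rw [h, hB]), ?_⟩
    change 2 ≤ (bits b.1 ∩ insert v (bits S)).card at this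
    omega
  have hconf : isInConflict bl (Nat.add S (2 ^ v)) (bif q then Nat.add g (2 ^ v) else g) = true
      := by
    rw [isInConflict, allPairs_eq_true]
    intro b hb
    obtain ⟨i, hi, j, hj, h1, h2⟩ := hT.conflict _ (inv.mem b hb) _ hmem (hne b hb)
    simp only [bitsPair] at hi hj h1 h2
    simp only [evalNat_eq]
    rw [Bool.and_eq_true, Bool.not_eq_true', Bool.not_eq_true', ← Bool.not_eq_true,
      ← Bool.not_eq_true, land_beq_zero, land_beq_iff, bits_xor, hNm, bits_land, hB]
    constructor
    · refine Finset.ne_empty_of_mem (a := j) (Finset.mem_inter.2 ⟨?_, hj⟩)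
      rw [Finset.mem_symmDiff]
      tauto
    · intro h
      have := h hi
      rw [Finset.mem_symmDiff] at this
      tauto
  rw [signedBlocks, List.mem_flatMap]
  refine ⟨2 ^ v, (hpts _).2 ⟨v, hv, rfl⟩, ?_⟩
  have h0 : Nat.beq (Nat.land S (2 ^ v)) 0 = true := by
    rw [land_beq_zero, bits_two_pow, Finset.inter_singleton, if_neg hvS]
  rw [h0, cond_true, evalNat_eq, hnew, cond_true, List.mem_filterMap]
  exact ⟨g, hg, by rw [evalNat_eq, hconf, cond_true]⟩

theorem exists_completions_of_bestCompletions {pts : List ℕ} {bl : List (ℕ × ℕ)} {f : ℕ → Bool}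
    {st : List ℕ} {cur : Option (List (ℕ × ℕ))} {c : List (ℕ × ℕ)}
    (h : bestCompletions pts bl f st cur = some c) :
    cur = some c ∨ ∃ S ∈ st, completions pts bl S = some c := by
  induction st generalizing cur with
  | nil => exact Or.inl h
  | cons S st ih =>
    have tail : ∀ {cur'}, bestCompletions pts bl f st cur' = some c →
        cur' = some c ∨ ∃ R ∈ S :: st, completions pts bl R = some c := fun h' =>
      (ih h').imp_right fun ⟨R, hR, h⟩ => ⟨R, List.mem_cons_of_mem S hR, h⟩
    have head : ∀ {c'}, completions pts bl S = some c' → some c' = some c →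
        ∃ R ∈ S :: st, completions pts bl R = some c := fun h1 h2 =>
      ⟨S, List.mem_cons_self, h1.trans h2⟩
    unfold bestCompletions at h
    cases hf : f S with
    | false =>
      rw [hf, cond_false] at h
      exact tail h
    | true =>
      rw [hf, cond_true] at h
      cases hc : completions pts bl S with
      | none =>
        simp only [hc] at h
        exact tail h
      | some d =>
        simp only [hc, evalPairs_eq] at h
        cases hl : Nat.ble d.length 2 with
        | true =>
          rw [hl, cond_true] at h
          exact Or.inr (head hc h)
        | false =>
          rw [hl, cond_false] at h
          cases cur with
          | none => exact Or.inr ((tail h).elim (head hc) id)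
          | some d' =>
            dsimp only at h
            cases hll : Nat.ble d'.length d.length with
            | true =>
              rw [hll, cond_true] at h
              exact tail h
            | false =>
              rw [hll, cond_false] at h
              exact Or.inr ((tail h).elim (head hc) id)

/-- If the signed blocks found so far do not balance at `S`, then there is a further one containing
`S`. After exchanging its fifth point with the next new point, if necessary, it is among the
completions. -/
theorem exists_mem_of_completions {T : Finset (Finset ℕ × Finset ℕ)} (hT : SignedSystem T)
    {n : ℕ} {pts : List ℕ} {bl : List (ℕ × ℕ)} {st : List ℕ} {m : ℕ}
    (inv : SignedInvariant T n pts bl st m) {S : ℕ} (hS : S ∈ st) {c : List (ℕ × ℕ)}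
    (h : completions (2 ^ n :: pts) bl S = some c) :
    ∃ T' : Finset (Finset ℕ × Finset ℕ), SignedSystem T' ∧ SignedInvariant T' n pts bl st m ∧
      ∃ b ∈ c, bitsPair b ∈ T' ∧ b ∉ bl ∧ bits b.1 ⊆ Finset.range (n + 1) := by
  have hS4 := inv.card_eq S hS
  have hSn := inv.stack_subset S hS
  set P := bl.toFinset.image bitsPair with hP
  have hPT : P ⊆ T := by
    intro p hp
    obtain ⟨b, hb, rfl⟩ := Finset.mem_image.1 hp
    exact inv.mem b (List.mem_toFinset.1 hb)
  have hpos : positiveDegree bl S = (P.filter fun p => bits S ⊆ p.1 ∧ p.2 ⊆ bits S).card :=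
    length_filter_eq_card inv.nodup _ _ fun b => by
      rw [Bool.and_eq_true, land_beq_iff, land_beq_iff']; rfl
  have hneg : negativeDegree bl S = (P.filter fun p => bits S ⊆ p.1 ∧ ¬ p.2 ⊆ bits S).card :=
    length_filter_eq_card inv.nodup _ _ fun b => by
      rw [Bool.and_eq_true, Bool.not_eq_true', ← Bool.not_eq_true, land_beq_iff, land_beq_iff']; rfl
  have hbal := hT.balance _ hS4
  simp only [completions, evalNat_eq] at h
  cases heq : Nat.beq (positiveDegree bl S) (negativeDegree bl S) with
  | true => simp [heq] at h
  | false =>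
  rw [heq, cond_false, Option.some_inj] at h
  rw [← Bool.not_eq_true, Nat.beq_eq] at heq
  -- a signed block of the required sign which is not yet in use
  obtain ⟨p, hpT, hpP, hSp, hsign⟩ : ∃ p ∈ T, p ∉ P ∧ bits S ⊆ p.1 ∧
      (¬ p.2 ⊆ bits S ↔ Nat.ble (negativeDegree bl S) (positiveDegree bl S) = true) := by
    by_cases hle : negativeDegree bl S ≤ positiveDegree bl S
    · have hlt : (P.filter fun p => bits S ⊆ p.1 ∧ ¬ p.2 ⊆ bits S).card <
          (T.filter fun p => bits S ⊆ p.1 ∧ ¬ p.2 ⊆ bits S).card := by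
        rw [← hbal, ← hneg]
        refine lt_of_lt_of_le (lt_of_le_of_ne hle (Ne.symm heq)) ?_
        rw [hpos]
        exact Finset.card_le_card (Finset.filter_subset_filter _ hPT)
      obtain ⟨p, hp, hp'⟩ := Finset.exists_mem_notMem_of_card_lt_card hlt
      rw [Finset.mem_filter] at hp hp'
      exact ⟨p, hp.1, fun hc => hp' ⟨hc, hp.2⟩, hp.2.1,
        iff_of_true hp.2.2 (Nat.ble_eq_true_of_le hle)⟩
    · have hlt : (P.filter fun p => bits S ⊆ p.1 ∧ p.2 ⊆ bits S).card <
          (T.filter fun p => bits S ⊆ p.1 ∧ p.2 ⊆ bits S).card := by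
        rw [hbal, ← hpos]
        refine lt_of_lt_of_le (not_le.1 hle) ?_
        rw [hneg]
        exact Finset.card_le_card (Finset.filter_subset_filter _ hPT)
      obtain ⟨p, hp, hp'⟩ := Finset.exists_mem_notMem_of_card_lt_card hlt
      rw [Finset.mem_filter] at hp hp'
      exact ⟨p, hp.1, fun hc => hp' ⟨hc, hp.2⟩, hp.2.1,
        iff_of_false (not_not.2 hp.2.2) (fun hb => hle (Nat.le_of_ble_eq_true hb))⟩
  obtain ⟨B, N⟩ := p
  dsimp only at hSp hsign
  have hsub := hT.subset _ hpT
  dsimp only at hsub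
  obtain ⟨v, hvS, rfl⟩ := exists_eq_insert_of_subset hSp (by
    rw [hS4]; exact hT.card_block _ hpT)
  have hq : v ∈ N ↔ Nat.ble (negativeDegree bl S) (positiveDegree bl S) = true := by
    rw [← hsign, ← not_iff_not, not_not]
    refine ⟨fun hvN x hx => (Finset.mem_insert.1 (hsub hx)).resolve_left fun h => hvN (h ▸ hx),
      fun h hvN => hvS (h hvN)⟩
  have finish : ∀ {T' : Finset (Finset ℕ × Finset ℕ)} {w : ℕ} {M : Finset ℕ}, SignedSystem T' →
      SignedInvariant T' n pts bl st m → w ∉ bits S → w < n + 1 → (insert w (bits S), M) ∈ T' →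
      (insert w (bits S), M) ∉ P → (w ∈ M ↔ v ∈ N) →
      ∃ T' : Finset (Finset ℕ × Finset ℕ), SignedSystem T' ∧ SignedInvariant T' n pts bl st m ∧
        ∃ b ∈ c, bitsPair b ∈ T' ∧ b ∉ bl ∧ bits b.1 ⊆ Finset.range (n + 1) := by
    intro T' w M hT' inv' hwS hw hmem hnot hM
    obtain ⟨b, hb, hbe⟩ := exists_mem_signedBlocks hT' inv' hSn hwS hw hmem hnot _ (hM.trans hq)
    refine ⟨T', hT', inv', b, h ▸ hb, hbe ▸ hmem, fun hbl => hnot ?_, ?_⟩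
    · rw [← hbe]
      exact Finset.mem_image_of_mem _ (List.mem_toFinset.2 hbl)
    · have : bits b.1 = insert w (bits S) := congrArg Prod.fst hbe
      rw [this, Finset.insert_subset_iff, Finset.mem_range]
      exact ⟨hw, hSn.trans (Finset.range_subset_range.2 (Nat.le_succ n))⟩
  rcases lt_or_ge v n with hvn | hvn
  · exact finish hT inv hvS (by omega) hpT hpP Iff.rfl
  · set σ := (Equiv.swap v n).toEmbedding with hσ
    have hnS : n ∉ bits S := fun hc => lt_irrefl n (Finset.mem_range.1 (hSn hc))
    have hfix : ∀ A : Finset ℕ, A ⊆ Finset.range n → A.map σ = A := fun A hA =>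
      map_swap_eq (fun hc => absurd (Finset.mem_range.1 (hA hc)) (by omega))
        (fun hc => absurd (Finset.mem_range.1 (hA hc)) (by omega))
    have hpair : mapPair σ (insert v (bits S), N) = (insert n (bits S), N.map σ) := by
      rw [mapPair, Finset.map_insert, hfix _ hSn, hσ, Equiv.coe_toEmbedding,
        Equiv.swap_apply_left]
    refine finish (hT.map σ) { inv with mem := ?_ } hnS (Nat.lt_succ_self n)
      (hpair ▸ Finset.mem_image_of_mem (mapPair σ) hpT) ?_ ?_ (M := N.map σ)
    · intro b hb
      have h1 := inv.subset_range b hb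
      have h2 : bits b.2 ⊆ Finset.range n := (hT.subset _ (inv.mem b hb)).trans h1
      have : mapPair σ (bitsPair b) = bitsPair b := by
        rw [mapPair, bitsPair, hfix _ h1, hfix _ h2]
      rw [← this]
      exact Finset.mem_image_of_mem _ (inv.mem b hb)
    · intro hc
      obtain ⟨b, hb, hbe⟩ := Finset.mem_image.1 hc
      have h1 := inv.subset_range b (List.mem_toFinset.1 hb)
      have h2 : bits b.1 = insert n (bits S) := congrArg Prod.fst hbe
      exact lt_irrefl n (Finset.mem_range.1 (h1 (h2 ▸ Finset.mem_insert_self n _)))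
    · have := Finset.mem_map' σ (a := v) (s := N)
      rw [hσ, Equiv.coe_toEmbedding, Equiv.swap_apply_left] at this
      exact this

/-- Soundness of the search. -/
theorem not_signedInvariant_of_signedSearch (fuel : ℕ) {T : Finset (Finset ℕ × Finset ℕ)}
    (hT : SignedSystem T) {n : ℕ} {pts : List ℕ} {bl : List (ℕ × ℕ)} {st : List ℕ} {m op : ℕ}
    (inv : SignedInvariant T n pts bl st m)
    (h : signedSearch fuel pts (2 ^ n) bl st m op = true) : False := by
  induction fuel generalizing T n pts bl st m op with
  | zero => exact absurd h (by simp [signedSearch])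
  | succ fuel ih =>
    unfold signedSearch at h
    split at h
    · exact absurd h (by decide)
    rename_i c hc
    have hex : ∃ S ∈ st, completions (2 ^ n :: pts) bl S = some c := by
      split at hc
      · rename_i c' hc'
        obtain rfl := Option.some_inj.1 hc
        exact (exists_completions_of_bestCompletions hc').resolve_left (by simp)
      · exact (exists_completions_of_bestCompletions hc).resolve_left (by simp)
    obtain ⟨S, hS, hcS⟩ := hex
    obtain ⟨T', hT', inv', b, hbc, hbT, hbl, hbn⟩ := exists_mem_of_completions hT inv hS hcS
    cases h16 : Nat.beq m 16 with
    | true =>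
      -- all 16 signed blocks are in use
      rw [Nat.beq_eq] at h16
      have hcard : (insert (bitsPair b) (bl.toFinset.image bitsPair)).card = 17 := by
        rw [Finset.card_insert_of_notMem, Finset.card_image_of_injective _ bitsPair_injective,
          List.toFinset_card_of_nodup inv'.nodup, inv'.length, h16]
        rw [Finset.mem_image]
        rintro ⟨d, hd, hdb⟩
        exact hbl (bitsPair_injective hdb ▸ List.mem_toFinset.1 hd)
      have hle : insert (bitsPair b) (bl.toFinset.image bitsPair) ⊆ T' := by
        rw [Finset.insert_subset_iff]
        refine ⟨hbT, fun p hp => ?_⟩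
        obtain ⟨d, hd, rfl⟩ := Finset.mem_image.1 hp
        exact inv'.mem d (List.mem_toFinset.1 hd)
      have := Finset.card_le_card hle
      rw [hcard, hT'.card_eq] at this
      omega
    | false =>
      rw [h16, cond_false, List.all_eq_true] at h
      have hb := h b hbc
      simp only [evalNat_eq] at hb
      set facets := ((2 ^ n :: pts).filter fun e => !Nat.beq (Nat.land b.1 e) 0).map (Nat.sub b.1)
        with hfacets
      have hfacet : ∀ R ∈ facets, (bits R).card = 4 ∧ bits R ⊆ bits b.1 := by
        intro R hR
        obtain ⟨e, he, rfl⟩ := List.mem_map.1 hR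
        rw [List.mem_filter, two_pow_mem_pts inv.pts, Bool.not_eq_true', ← Bool.not_eq_true,
          land_beq_zero] at he
        obtain ⟨⟨i, -, rfl⟩, hi⟩ := he
        rw [bits_two_pow, Finset.inter_singleton] at hi
        have hi' : i ∈ bits b.1 := by_contra fun hc => hi (if_neg hc)
        have : bits (Nat.sub b.1 (2 ^ i)) = (bits b.1).erase i := bits_sub_two_pow hi'
        rw [this, Finset.card_erase_of_mem hi']
        have h5 := hT'.card_block _ hbT
        change (bits b.1).card = 5 at h5
        rw [h5]
        exact ⟨rfl, Finset.erase_subset _ _⟩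
      have step : ∀ {n' : ℕ} {pts' : List ℕ}, n ≤ n' → (∀ p, p ∈ pts' ↔ ∃ i < n', p = 2 ^ i) →
          bits b.1 ⊆ Finset.range n' →
          SignedInvariant T' n' pts' (b :: bl) (facets ++ st) (m + 1) := by
        intro n' pts' hn hpts' hbn'
        refine ⟨hpts', ?_, ?_, ?_, ?_, ?_, ?_⟩
        · exact List.forall_mem_cons.2 ⟨hbT, inv'.mem⟩
        · exact List.forall_mem_cons.2 ⟨hbn', fun d hd =>
            (inv'.subset_range d hd).trans (Finset.range_subset_range.2 hn)⟩
        · exact List.nodup_cons.2 ⟨hbl, inv'.nodup⟩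
        · rw [List.length_cons, inv'.length]
        · intro R hR
          rcases List.mem_append.1 hR with hR | hR
          · exact (hfacet R hR).1
          · exact inv'.card_eq R hR
        · intro R hR
          rcases List.mem_append.1 hR with hR | hR
          · exact (hfacet R hR).2.trans hbn'
          · exact (inv'.stack_subset R hR).trans (Finset.range_subset_range.2 hn)
      cases hlt : Nat.ble (2 ^ n) b.1 with
      | true =>
        rw [hlt, cond_true] at hb
        have hpow : Nat.mul 2 (2 ^ n) = 2 ^ (n + 1) := by
          rw [pow_succ, mul_comm]; rfl
        rw [hpow] at hb
        exact ih hT' (step (Nat.le_succ n) (two_pow_mem_pts inv.pts) hbn) hb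
      | false =>
        rw [hlt, cond_false] at hb
        rw [← Bool.not_eq_true, Nat.ble_eq, not_le] at hlt
        exact ih hT' (step le_rfl inv.pts (bits_subset_range.2 hlt)) hb

/-! ### Each 4-set lies in at most two blocks -/

section

variable {V : Type*} [DecidableEq V]

/-- Switching at the point `v` of a block `insert v S` replaces the restriction of its sign to `S`
by the opposite one. -/
theorem switchPair_singleton_insert {v : V} {S M : Finset V} (hv : v ∉ S) (hM : M ⊆ S) :
    switchPair {v} (insert v S, M) = (insert v S, S \ M) := by
  have hvM : v ∉ M := fun h => hv (hM h)
  refine Prod.ext rfl ?_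
  ext i
  have hG : insert v S ∩ {v} = {v} :=
    Finset.inter_singleton_of_mem (Finset.mem_insert_self v S)
  simp only [switchPair, hG, Finset.card_singleton, Nat.not_even_one, if_false,
    Finset.mem_sdiff, Finset.mem_insert, Finset.mem_symmDiff, Finset.mem_singleton]
  by_cases h : i = v
  · subst h; simp [hv, hvM]
  · simp [h]

theorem switchPair_singleton_insert' {v : V} {S M : Finset V} (hv : v ∉ S) (hM : M ⊆ S) :
    switchPair {v} (insert v S, insert v M) = (insert v S, insert v (S \ M)) := by
  have hvM : v ∉ M := fun h => hv (hM h)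
  refine Prod.ext rfl ?_
  ext i
  have hG : insert v S ∩ {v} = {v} :=
    Finset.inter_singleton_of_mem (Finset.mem_insert_self v S)
  simp only [switchPair, hG, Finset.card_singleton, Nat.not_even_one, if_false,
    Finset.mem_sdiff, Finset.mem_insert, Finset.mem_symmDiff, Finset.mem_singleton]
  by_cases h : i = v
  · subst h; simp
  · simp [h]

theorem switchPair_of_disjoint {G : Finset V} {p : Finset V × Finset V} (h : Disjoint p.1 G) :
    switchPair G p = p := by
  rw [Finset.disjoint_iff_inter_eq_empty] at h
  refine Prod.ext rfl ?_
  simp [switchPair, h]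

/-- Switching with respect to an even subset of `S` changes the restrictions of signs to `S`. -/
theorem switchPair_insert_of_even {v : V} {S G M : Finset V} (hG : G ⊆ S)
    (he : Even G.card) : switchPair G (insert v S, M) = (insert v S, symmDiff M G) := by
  have h : insert v S ∩ G = G :=
    Finset.inter_eq_right.2 (hG.trans (Finset.subset_insert v S))
  simp only [switchPair, h, he, if_true]

end

theorem startFacets_card : ∀ S ∈ startFacets, (bits S).card = 4 := by decide +kernel

theorem startFacets_subset : ∀ S ∈ startFacets, bits S ⊆ Finset.range 8 := by decide +kernel

/-- The start configurations of `signedSearch` do not occur in a signed system. -/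
theorem SignedSystem.false_of_mem {T : Finset (Finset ℕ × Finset ℕ)} (hT : SignedSystem T)
    (x : Fin 8 ↪ ℕ) {q : Fin 8} (hq : q = 1 ∨ q = 2)
    (ha : (({4, 0, 1, 2, 3} : Finset (Fin 8)).map x, (∅ : Finset (Fin 8)).map x) ∈ T)
    (hb : (({5, 0, 1, 2, 3} : Finset (Fin 8)).map x, ({0, 1} : Finset (Fin 8)).map x) ∈ T)
    (hc : (({6, 0, 1, 2, 3} : Finset (Fin 8)).map x, ({6, 0} : Finset (Fin 8)).map x) ∈ T)
    (hd : (({7, 0, 1, 2, 3} : Finset (Fin 8)).map x, ({7, q} : Finset (Fin 8)).map x) ∈ T) :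
    False := by
  obtain ⟨g, hg⟩ := (Equiv.Perm.isMultiplyPretransitive ℕ 8).exists_smul_eq x Fin.valEmbedding
  have hxg : x.trans g.toEmbedding = Fin.valEmbedding := by
    ext i
    exact DFunLike.congr_fun hg i
  have hT' := hT.map g.toEmbedding
  have hmem : ∀ A N : Finset (Fin 8), (A.map x, N.map x) ∈ T →
      (A.map Fin.valEmbedding, N.map Fin.valEmbedding) ∈ T.image (mapPair g.toEmbedding) := by
    intro A N h
    have := Finset.mem_image_of_mem (mapPair g.toEmbedding) h
    rwa [mapPair, Finset.map_map, Finset.map_map, hxg] at this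
  have hinv : ∀ b : ℕ × ℕ, b = (143, 130) ∨ b = (143, 132) →
      bitsPair b ∈ T.image (mapPair g.toEmbedding) →
      SignedInvariant (T.image (mapPair g.toEmbedding)) 8 [128, 64, 32, 16, 8, 4, 2, 1]
        [(31, 0), (47, 3), (79, 65), b] startFacets 4 := by
    intro b hb' hbT
    have ea : bitsPair (31, 0) = (({4, 0, 1, 2, 3} : Finset (Fin 8)).map Fin.valEmbedding,
      (∅ : Finset (Fin 8)).map Fin.valEmbedding) := by decide
    have eb : bitsPair (47, 3) = (({5, 0, 1, 2, 3} : Finset (Fin 8)).map Fin.valEmbedding,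
      ({0, 1} : Finset (Fin 8)).map Fin.valEmbedding) := by decide
    have ec : bitsPair (79, 65) = (({6, 0, 1, 2, 3} : Finset (Fin 8)).map Fin.valEmbedding,
      ({6, 0} : Finset (Fin 8)).map Fin.valEmbedding) := by decide
    refine ⟨?_, ?_, ?_, ?_, rfl, startFacets_card, startFacets_subset⟩
    · have : [128, 64, 32, 16, 8, 4, 2, 1] = ((List.range 8).map (2 ^ ·)).reverse := by decide
      simp [this, eq_comm]
    · simp only [List.forall_mem_cons]
      exact ⟨ea ▸ hmem _ _ ha, eb ▸ hmem _ _ hb, ec ▸ hmem _ _ hc, hbT, by simp⟩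
    · rcases hb' with rfl | rfl <;> decide
    · rcases hb' with rfl | rfl <;> decide
  rcases hq with rfl | rfl
  · have e : bitsPair (143, 130) = (({7, 0, 1, 2, 3} : Finset (Fin 8)).map Fin.valEmbedding,
      ({7, 1} : Finset (Fin 8)).map Fin.valEmbedding) := by decide
    exact not_signedInvariant_of_signedSearch _ hT' (n := 8)
      (hinv _ (Or.inl rfl) (e ▸ hmem _ _ hd)) signedSearch_eq_true₁
  · have e : bitsPair (143, 132) = (({7, 0, 1, 2, 3} : Finset (Fin 8)).map Fin.valEmbedding,
      ({7, 2} : Finset (Fin 8)).map Fin.valEmbedding) := by decide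
    exact not_signedInvariant_of_signedSearch _ hT' (n := 8)
      (hinv _ (Or.inr rfl) (e ▸ hmem _ _ hd)) signedSearch_eq_true₂

/-- The form of `SignedSystem.false_of_mem` in which the points are not numbered. -/
theorem SignedSystem.false_of_mem' {T : Finset (Finset ℕ × Finset ℕ)} (hT : SignedSystem T)
    {S D : Finset ℕ} (hS : S.card = 4) {a b c d p q : ℕ} (ha : a ∉ S) (hb : b ∉ S) (hc : c ∉ S)
    (hd : d ∉ S) (hnd : [a, b, c, d].Nodup) (hDS : D ⊆ S) (hD : D.card = 2) (hp : p ∈ D)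
    (hq : q ∈ S) (hpq : p ≠ q)
    (hTa : (insert a S, ∅) ∈ T) (hTb : (insert b S, D) ∈ T) (hTc : (insert c S, {c, p}) ∈ T)
    (hTd : (insert d S, {d, q}) ∈ T) : False := by
  obtain ⟨r, hr⟩ := Finset.card_eq_one.1 (by
    rw [Finset.card_erase_of_mem hp, hD] : (D.erase p).card = 1)
  have hDpr : D = {p, r} := by rw [← hr, Finset.insert_erase hp]
  have hpr : r ≠ p := by
    have : r ∈ D.erase p := by rw [hr]; exact Finset.mem_singleton_self r
    exact Finset.ne_of_mem_erase this
  have hpS := hDS hp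
  have hrS : r ∈ S := hDS (by rw [hDpr]; simp)
  obtain ⟨i, k, hnd4, hSeq, hqi⟩ : ∃ i k, [p, r, i, k].Nodup ∧ S = {p, r, i, k} ∧
      (q = r ∨ q = i) := by
    by_cases hqr : q = r
    · obtain ⟨i, k, hik, h⟩ := Finset.card_eq_two.1 (by
        rw [Finset.card_sdiff_of_subset hDS, hS, hD] : (S \ D).card = 2)
      have hi : i ∈ S \ D := by rw [h]; simp
      have hk : k ∈ S \ D := by rw [h]; simp
      rw [Finset.mem_sdiff, hDpr] at hi hk
      simp only [Finset.mem_insert, Finset.mem_singleton, not_or] at hi hk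
      refine ⟨i, k, ?_, ?_, Or.inl hqr⟩
      · simp only [List.nodup_cons, List.mem_cons, List.not_mem_nil, or_false, not_or]
        refine ⟨⟨hpr.symm, Ne.symm hi.2.1, Ne.symm hk.2.1⟩, ⟨Ne.symm hi.2.2, Ne.symm hk.2.2⟩, hik,
          not_false, List.nodup_nil⟩
      · rw [← Finset.union_sdiff_of_subset hDS, h, hDpr]
        ext x
        simp only [Finset.mem_union, Finset.mem_insert, Finset.mem_singleton]
        tauto
    · have hqD : q ∈ S \ D := by
        rw [Finset.mem_sdiff, hDpr]
        simp [hq, hpq.symm, hqr]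
      obtain ⟨k, hk'⟩ := Finset.card_eq_one.1 (by
        rw [Finset.card_erase_of_mem hqD, Finset.card_sdiff_of_subset hDS, hS, hD] :
        ((S \ D).erase q).card = 1)
      have hk : k ∈ (S \ D).erase q := by rw [hk']; simp
      rw [Finset.mem_erase, Finset.mem_sdiff, hDpr] at hk
      simp only [Finset.mem_insert, Finset.mem_singleton, not_or] at hk
      refine ⟨q, k, ?_, ?_, Or.inr rfl⟩
      · simp only [List.nodup_cons, List.mem_cons, List.not_mem_nil, or_false, not_or]
        exact ⟨⟨hpr.symm, hpq, Ne.symm hk.2.2.1⟩, ⟨Ne.symm hqr, Ne.symm hk.2.2.2⟩, Ne.symm hk.1,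
          not_false, List.nodup_nil⟩
      · rw [← Finset.union_sdiff_of_subset hDS, ← Finset.insert_erase hqD, hk', hDpr]
        ext x
        simp only [Finset.mem_union, Finset.mem_insert, Finset.mem_singleton]
        tauto
  have hinj : Function.Injective ![p, r, i, k, a, b, c, d] := by
    have : ([p, r, i, k] ++ [a, b, c, d]).Nodup := by
      rw [List.nodup_append]
      refine ⟨hnd4, hnd, ?_⟩
      have h1 : ∀ x ∈ [p, r, i, k], x ∈ S := by
        intro x hx
        rw [hSeq]
        simpa using hx
      have h2 : ∀ x ∈ [a, b, c, d], x ∉ S := by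
        simp [ha, hb, hc, hd]
      exact fun x hx y hy h => h2 y hy (h ▸ h1 x hx)
    exact List.nodup_ofFn.1 (by simpa [List.ofFn_succ] using this)
  refine hT.false_of_mem ⟨_, hinj⟩ (q := if q = r then 1 else 2) ?_ ?_ ?_ ?_ ?_
  · split_ifs <;> simp
  · simpa [Finset.map_insert, ← hSeq] using hTa
  · simpa [Finset.map_insert, ← hSeq, ← hDpr] using hTb
  · simpa [Finset.map_insert, ← hSeq] using hTc
  · split_ifs with h
    · simpa [Finset.map_insert, ← hSeq, h] using hTd
    · simpa [Finset.map_insert, ← hSeq, hqi.resolve_left h] using hTd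

theorem SignedSystem.switch_singleton_mem {T : Finset (Finset ℕ × Finset ℕ)} {S N : Finset ℕ}
    {v w : ℕ} (hv : v ∉ S) (hw : w ≠ v) (h : (insert w S, N) ∈ T) :
    (insert w S, N) ∈ T.image (switchPair {v}) := by
  have e : switchPair {v} (insert w S, N) = (insert w S, N) := by
    refine switchPair_of_disjoint (Finset.disjoint_singleton_right.2 fun hc => ?_)
    rcases Finset.mem_insert.1 hc with h | h
    exacts [hw h.symm, hv h]
  exact e ▸ Finset.mem_image_of_mem (switchPair {v}) h

/-- A block `insert v S` whose sign differs on `S` can be switched such that exactly one point of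
`S` has the same sign as `v`. -/
theorem SignedSystem.exists_switch {T : Finset (Finset ℕ × Finset ℕ)} (hT : SignedSystem T)
    {S N : Finset ℕ} (hS : S.card = 4) {v : ℕ} (hv : v ∉ S) (h : (insert v S, N) ∈ T)
    (hvN : v ∈ N) : ∃ T', SignedSystem T' ∧ (∃ p ∈ S, (insert v S, {v, p}) ∈ T') ∧
      ∀ w M, w ≠ v → (insert w S, M) ∈ T → (insert w S, M) ∈ T' := by
  have hsub := hT.subset _ h
  have heven := hT.even _ h
  dsimp only at hsub heven
  have hM : N.erase v ⊆ S := fun i hi =>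
    (Finset.mem_insert.1 (hsub (Finset.mem_of_mem_erase hi))).resolve_left
      (Finset.ne_of_mem_erase hi)
  have hle := Finset.card_le_card hM
  have hcard := Finset.card_erase_add_one hvN
  rw [← hcard] at heven
  obtain ⟨r, hr⟩ := heven
  rw [← Finset.insert_erase hvN] at h
  obtain h1 | h3 : (N.erase v).card = 1 ∨ (S \ N.erase v).card = 1 := by
    rw [Finset.card_sdiff_of_subset hM]
    omega
  · obtain ⟨p, hp⟩ := Finset.card_eq_one.1 h1
    rw [hp] at h hM
    exact ⟨T, hT, ⟨p, hM (Finset.mem_singleton_self p), h⟩, fun _ _ _ h => h⟩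
  · obtain ⟨p, hp⟩ := Finset.card_eq_one.1 h3
    refine ⟨_, hT.switch {v}, ⟨p, ?_, ?_⟩, fun w M hw h => switch_singleton_mem hv hw h⟩
    · exact (Finset.mem_sdiff.1 (hp ▸ Finset.mem_singleton_self p)).1
    · have := Finset.mem_image_of_mem (switchPair {v}) h
      rwa [switchPair_singleton_insert' hv hM, hp] at this

/-- In a signed system, each 4-set lies in at most two blocks. Otherwise it lies in two positive and
two negative blocks, which switching and renumbering bring to one of the start configurations. -/
theorem SignedSystem.blockDegree_le_two {T : Finset (Finset ℕ × Finset ℕ)} (hT : SignedSystem T)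
    {S : Finset ℕ} (hS : S.card = 4) : blockDegree (T.image Prod.fst) S ≤ 2 := by
  by_contra hlt
  have hdeg := hT.blockDegree_eq_two_mul hS
  have hbal := hT.balance S hS
  have hneg : 1 < (T.filter fun p => S ⊆ p.1 ∧ ¬ p.2 ⊆ S).card := by omega
  have hpos := hneg
  rw [← hbal] at hpos
  obtain ⟨⟨A, Na⟩, hTa, ⟨B, Nb⟩, hTb, hab⟩ := Finset.one_lt_card.1 hpos
  obtain ⟨⟨C, Nc⟩, hTc, ⟨D, Nd⟩, hTd, hcd⟩ := Finset.one_lt_card.1 hneg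
  simp only [Finset.mem_filter] at hTa hTb hTc hTd
  obtain ⟨hTa, hSA, hNa⟩ := hTa
  obtain ⟨hTb, hSB, hNb⟩ := hTb
  obtain ⟨hTc, hSC, hNc⟩ := hTc
  obtain ⟨hTd, hSD, hNd⟩ := hTd
  have hins : ∀ {B N : Finset ℕ}, (B, N) ∈ T → S ⊆ B → ∃ v ∉ S, B = insert v S := fun h hs =>
    exists_eq_insert_of_subset hs (by rw [hS]; exact hT.card_block _ h)
  obtain ⟨a, ha, rfl⟩ := hins hTa hSA
  obtain ⟨b, hb, rfl⟩ := hins hTb hSB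
  obtain ⟨c, hc, rfl⟩ := hins hTc hSC
  obtain ⟨d, hd, rfl⟩ := hins hTd hSD
  have hmemN : ∀ {v : ℕ} {N : Finset ℕ}, (insert v S, N) ∈ T → ¬ N ⊆ S → v ∈ N := by
    intro v N h hN
    by_contra hv
    exact hN fun x hx => (Finset.mem_insert.1 (hT.subset _ h hx)).resolve_left fun e => hv (e ▸ hx)
  have hcN := hmemN hTc hNc
  have hdN := hmemN hTd hNd
  -- blocks with the same fifth point have the same sign
  have hsame : ∀ {v w : ℕ} {M N : Finset ℕ}, (insert v S, M) ∈ T → (insert w S, N) ∈ T →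
      v = w → M = N := by
    rintro v w M N h1 h2 rfl
    exact congrArg Prod.snd (hT.eq_of_fst _ h1 _ h2 rfl)
  have hne1 : a ≠ b := fun h => hab (by rw [hsame hTa hTb h, h])
  have hne2 : a ≠ c := fun h => hNc (hsame hTa hTc h ▸ hNa)
  have hne3 : a ≠ d := fun h => hNd (hsame hTa hTd h ▸ hNa)
  have hne4 : b ≠ c := fun h => hNc (hsame hTb hTc h ▸ hNb)
  have hne5 : b ≠ d := fun h => hNd (hsame hTb hTd h ▸ hNb)
  have hne6 : c ≠ d := fun h => hcd (by rw [hsame hTc hTd h, h])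
  have hnd : [a, b, c, d].Nodup := by
    simp [hne1, hne2, hne3, hne4, hne5, hne6]
  -- make the sign of the first block trivial
  have hsw : ∀ {v : ℕ} {N : Finset ℕ}, (insert v S, N) ∈ T →
      (insert v S, symmDiff N Na) ∈ T.image (switchPair Na) := by
    intro v N h
    have := Finset.mem_image_of_mem (switchPair Na) h
    rwa [switchPair_insert_of_even hNa (hT.even _ hTa)] at this
  have hT1 := hT.switch Na
  have hTa1 := hsw hTa
  have hTb1 := hsw hTb
  rw [symmDiff_self, Finset.bot_eq_empty] at hTa1
  obtain ⟨T2, hT2, ⟨p, hp, hTc2⟩, hkeep2⟩ := hT1.exists_switch hS hc (hsw hTc)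
    (Finset.mem_symmDiff.2 (Or.inl ⟨hcN, fun h => hc (hNa h)⟩))
  obtain ⟨T3, hT3, ⟨q, hq, hTd3⟩, hkeep3⟩ := hT2.exists_switch hS hd
    (hkeep2 _ _ hne6.symm (hsw hTd)) (Finset.mem_symmDiff.2 (Or.inl ⟨hdN, fun h => hd (hNa h)⟩))
  have hTa3 := hkeep3 _ _ hne3 (hkeep2 _ _ hne2 hTa1)
  have hTb3 := hkeep3 _ _ hne5 (hkeep2 _ _ hne4 hTb1)
  have hTc3 := hkeep3 _ _ hne6 hTc2
  set K := symmDiff Nb Na with hK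
  have hKS : K ⊆ S := by
    intro x hx
    rcases Finset.mem_symmDiff.1 hx with h | h
    exacts [hNb h.1, hNa h.1]
  have hinter : ∀ {v w i : ℕ}, v ≠ w → i ∈ insert v S ∩ insert w S → i ∈ S := by
    intro v w i hvw hi
    rw [Finset.mem_inter, Finset.mem_insert, Finset.mem_insert] at hi
    rcases hi with ⟨rfl | h, h' | h'⟩
    exacts [absurd h' hvw, h', h, h]
  -- the first two blocks are in conflict
  have hK2 : K.card = 2 := by
    obtain ⟨i, hi, j, hj, h1, h2⟩ := hT3.conflict _ hTa3 _ hTb3 fun h =>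
      hne1 (by
        have e : insert a S = insert b S := congrArg Prod.fst h
        exact (Finset.mem_insert.1 (e ▸ Finset.mem_insert_self a S)).resolve_right ha)
    have hiS := hinter hne1 hi
    simp only [Finset.notMem_empty, false_iff, not_not] at h1 h2
    have hev := hT3.even _ hTb3
    have hlt : K.card < 4 := by
      rw [← hS]
      exact Finset.card_lt_card (Finset.ssubset_iff_subset_ne.2 ⟨hKS, fun h => h1 (h ▸ hiS)⟩)
    have hgt : 0 < K.card := Finset.card_pos.2 ⟨j, h2⟩
    obtain ⟨r, hr⟩ := hev
    dsimp only at hr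
    omega
  -- the last two blocks are in conflict
  have hpq : p ≠ q := by
    rintro rfl
    obtain ⟨i, -, j, hj, -, h2⟩ := hT3.conflict _ hTc3 _ hTd3 fun h =>
      hne6 (by
        have e : insert c S = insert d S := congrArg Prod.fst h
        exact (Finset.mem_insert.1 (e ▸ Finset.mem_insert_self c S)).resolve_right hc)
    have hjS := hinter hne6 hj
    refine h2 ?_
    simp only [Finset.mem_insert, Finset.mem_singleton]
    have e1 : j ≠ c := fun h => hc (h ▸ hjS)
    have e2 : j ≠ d := fun h => hd (h ▸ hjS)
    simp [e1, e2]
  by_cases hpK : p ∈ K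
  · exact hT3.false_of_mem' hS ha hb hc hd hnd hKS hK2 hpK hq hpq hTa3 hTb3 hTc3 hTd3
  · have hTb4 := Finset.mem_image_of_mem (switchPair {b}) hTb3
    rw [switchPair_singleton_insert hb hKS] at hTb4
    exact (hT3.switch {b}).false_of_mem' hS ha hb hc hd hnd Finset.sdiff_subset
      (by rw [Finset.card_sdiff_of_subset hKS, hS, hK2])
      (Finset.mem_sdiff.2 ⟨hp, hpK⟩) hq hpq (switch_singleton_mem hb hne1 hTa3) hTb4
      (switch_singleton_mem hb hne4.symm hTc3) (switch_singleton_mem hb hne5.symm hTd3)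

/-! ### Classification of signed systems -/

/-- The state in which a search from the block `{0, 1, 2, 3, 4}` starts. -/
theorem searchInvariant_singleton {U : Finset (Finset ℕ)} (h : bits 31 ∈ U) :
    SearchInvariant U 5 [1, 2, 4, 8, 16] [31] 1 (2 ^ 30 + 2 ^ 29 + 2 ^ 27 + 2 ^ 23 + 2 ^ 15)
      0 5 := by
  have hdeg : ∀ S, blockDegree (blocksOf [31]) S = if S ⊆ bits 31 then 1 else 0 := by
    intro S
    have : blocksOf [31] = {bits 31} := by simp [blocksOf]
    rw [this, blockDegree, Finset.filter_singleton]
    split_ifs <;> rfl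
  have hop : bits (2 ^ 30 + 2 ^ 29 + 2 ^ 27 + 2 ^ 23 + 2 ^ 15) = {30, 29, 27, 23, 15} := by
    decide +kernel
  refine ⟨?_, ?_, ?_, by simp, rfl, ?_, by simp, ?_⟩
  · have : [1, 2, 4, 8, 16] = (List.range 5).map (2 ^ ·) := by decide
    simp [this, eq_comm]
  · simp only [List.forall_mem_singleton]
    decide
  · simpa using h
  · intro S
    rw [← mem_bits, hop, hdeg]
    constructor
    · have : ∀ S ∈ ({30, 29, 27, 23, 15} : Finset ℕ),
          (bits S).card = 4 ∧ Odd (if bits S ⊆ bits 31 then 1 else 0) := by decide +kernel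
      exact this S
    · rintro ⟨h4, hodd⟩
      have hsub : bits S ⊆ bits 31 := by
        by_contra hc
        rw [if_neg hc] at hodd
        exact absurd hodd (by decide)
      have hlt : S < 2 ^ 5 := bits_subset_range.1 (hsub.trans (by decide))
      have : ∀ S < 2 ^ 5, (bits S).card = 4 → S ∈ ({30, 29, 27, 23, 15} : Finset ℕ) := by
        decide +kernel
      exact this S hlt h4
  · decide +kernel

/-- The blocks of a signed system form a copy of `E` or of `F`. -/
theorem SignedSystem.unitradeEquiv_nat {T : Finset (Finset ℕ × Finset ℕ)} (hT : SignedSystem T) :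
    UnitradeEquiv unitradeE (T.image Prod.fst) ∨ UnitradeEquiv unitradeF (T.image Prod.fst) := by
  obtain ⟨p, hp⟩ := Finset.card_pos.1 (by rw [hT.card_eq]; norm_num : 0 < T.card)
  have h5 := hT.card_block p hp
  obtain ⟨g, hg⟩ := (Equiv.Perm.isMultiplyPretransitive ℕ 5).exists_smul_eq
    (p.1.orderEmbOfFin h5).toEmbedding Fin.valEmbedding
  have hpg : p.1.map g.toEmbedding = bits 31 := by
    have h1 : p.1 = Finset.univ.map (p.1.orderEmbOfFin h5).toEmbedding := by
      rw [Finset.map_orderEmbOfFin_univ]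
    have h2 : (p.1.orderEmbOfFin h5).toEmbedding.trans g.toEmbedding = Fin.valEmbedding := by
      ext i
      exact DFunLike.congr_fun hg i
    rw [h1, Finset.map_map, h2]
    decide
  have hblocks := image_fst_image_mapPair T g.toEmbedding
  have h := unitradeEquiv_of_blockSearch (fun T hT S hS => hT.blockDegree_le_two hS) 17
    (hT.map g.toEmbedding) (searchInvariant_singleton (by
      rw [hblocks, ← hpg, Finset.mem_map]
      exact ⟨_, Finset.mem_image_of_mem _ hp, rfl⟩)) blockSearch_eq_true
  have hback : T.image Prod.fst = ((T.image (mapPair g.toEmbedding)).image Prod.fst).map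
      (Finset.mapEmbedding g.symm.toEmbedding).toEmbedding := by
    have hgg : g.toEmbedding.trans g.symm.toEmbedding = Function.Embedding.refl ℕ := by
      ext x; simp
    ext A
    simp [hblocks, Finset.mem_map, Finset.map_map, hgg]
  rw [hback]
  exact h.imp (UnitradeEquiv.trans_map _) (UnitradeEquiv.trans_map _)

/-! ### Partitions of the cube into faces -/

section

variable {V : Type*} [DecidableEq V] {ι : Type*} [Fintype ι] {b t : ι → Finset V}

/-- Different faces of a partition differ at a common fixed coordinate. -/
theorem exists_mem_inter_of_ne (ht : ∀ i, t i ⊆ b i)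
    (hone : ∀ X : Finset V, (Finset.univ.filter fun i => X ∩ b i = t i).card = 1)
    {i j : ι} (hij : i ≠ j) : ∃ v ∈ b i ∩ b j, ¬(v ∈ t i ↔ v ∈ t j) := by
  by_contra! hc
  obtain ⟨l, hl⟩ := Finset.card_eq_one.1 (hone (t i ∪ t j))
  have hmem : ∀ m, (t i ∪ t j) ∩ b m = t m → m = l := by
    intro m hm
    have : m ∈ Finset.univ.filter fun m => (t i ∪ t j) ∩ b m = t m := by simpa using hm
    rw [hl] at this
    exact Finset.mem_singleton.1 this
  refine hij ((hmem i ?_).trans (hmem j ?_).symm)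
  · ext v
    have h1 := hc v
    have h2 := @ht i v
    have h3 := @ht j v
    simp only [Finset.mem_inter, Finset.mem_union] at h1 ⊢
    tauto
  · ext v
    have h1 := hc v
    have h2 := @ht i v
    have h3 := @ht j v
    simp only [Finset.mem_inter, Finset.mem_union] at h1 ⊢
    tauto

/-- The Fourier coefficient at `S ≠ ∅` of the function counting the faces through a vertex
vanishes. Only the faces whose fixed coordinates include `S` contribute to it. -/
theorem sum_neg_one_pow_card
    (hone : ∀ X : Finset V, (Finset.univ.filter fun i => X ∩ b i = t i).card = 1)
    {S : Finset V} (hS : S.Nonempty) :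
    ∑ i ∈ Finset.univ.filter (fun i => S ⊆ b i ∧ t i ⊆ S), (-1 : ℤ) ^ (t i).card = 0 := by
  have h0 := Finset.sum_powerset_neg_one_pow_card_of_nonempty hS
  have h1 : ∑ W ∈ S.powerset, (-1 : ℤ) ^ W.card =
      ∑ W ∈ S.powerset, ∑ i, if W ∩ b i = t i then (-1 : ℤ) ^ W.card else 0 := by
    refine Finset.sum_congr rfl fun W _ => ?_
    rw [← Finset.sum_filter, Finset.sum_const, hone W, one_smul]
  rw [h0, Finset.sum_comm] at h1
  rw [h1, Finset.sum_filter]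
  refine Finset.sum_congr rfl fun i _ => ?_
  rw [← Finset.sum_filter]
  by_cases hSb : S ⊆ b i
  · have hW : S.powerset.filter (fun W => W ∩ b i = t i) = if t i ⊆ S then {t i} else ∅ := by
      ext W
      rw [Finset.mem_filter, Finset.mem_powerset]
      constructor
      · rintro ⟨hWS, hWb⟩
        rw [Finset.inter_eq_left.2 (hWS.trans hSb)] at hWb
        rw [← hWb, if_pos hWS]
        exact Finset.mem_singleton_self W
      · intro h
        split_ifs at h with hts
        · rw [Finset.mem_singleton] at h
          rw [h]
          exact ⟨hts, Finset.inter_eq_left.2 (hts.trans hSb)⟩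
        · simp at h
    rw [hW]
    by_cases hts : t i ⊆ S <;> simp [hSb, hts]
  · obtain ⟨v, hvS, hvb⟩ := Finset.not_subset.1 hSb
    rw [if_neg (fun h => hSb h.1)]
    -- pair off the sets `W` that differ in `v`
    symm
    refine Finset.sum_involution (fun W _ => symmDiff W {v}) ?_ ?_ ?_ ?_
    · intro W _
      have : Even (symmDiff W {v}).card ↔ ¬ Even W.card := by
        rw [even_card_symmDiff]
        simp
      by_cases he : Even W.card
      · rw [he.neg_one_pow, (Nat.not_even_iff_odd.1 (fun h => this.1 h he)).neg_one_pow]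
        rfl
      · rw [(Nat.not_even_iff_odd.1 he).neg_one_pow, (this.2 he).neg_one_pow]
        rfl
    · intro W _ _ h
      have := symmDiff_eq_left.1 h
      simp at this
    · intro W hW
      rw [Finset.mem_filter, Finset.mem_powerset] at hW ⊢
      constructor
      · intro x hx
        rcases Finset.mem_symmDiff.1 hx with h | h
        · exact hW.1 h.1
        · rw [Finset.mem_singleton.1 h.1]
          exact hvS
      · rw [← hW.2]
        ext x
        have : x ∈ b i → x ≠ v := fun h e => hvb (e ▸ h)
        simp only [Finset.mem_inter, Finset.mem_symmDiff, Finset.mem_singleton]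
        tauto
    · intro W _
      exact symmDiff_symmDiff_cancel_right _ _

end

section

variable {V : Type*} [Fintype V] [DecidableEq V]

/-- The number of vertex sets `X` in the face given by `X ∩ b = t`. -/
theorem card_filter_inter_eq {b t : Finset V} (h : t ⊆ b) :
    (Finset.univ.filter fun X : Finset V => X ∩ b = t).card = 2 ^ (Fintype.card V - b.card) := by
  have : (Finset.univ.filter fun X : Finset V => X ∩ b = t) = bᶜ.powerset.image (· ∪ t) := by
    ext X
    simp only [Finset.mem_filter, Finset.mem_univ, true_and, Finset.mem_image,
      Finset.mem_powerset]
    constructor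
    · rintro rfl
      refine ⟨X \ b, ?_, ?_⟩
      · rw [Finset.sdiff_eq_inter_compl]
        exact Finset.inter_subset_right
      · exact Finset.sdiff_union_inter X b
    · rintro ⟨Y, hY, rfl⟩
      have hYb : Disjoint Y b := by
        rwa [← Finset.subset_compl_iff_disjoint_right]
      rw [Finset.union_inter_distrib_right, Finset.disjoint_iff_inter_eq_empty.1 hYb,
        Finset.empty_union, Finset.inter_eq_left.2 h]
  rw [this, Finset.card_image_of_injOn, Finset.card_powerset, Finset.card_compl]
  intro Y hY Z hZ hYZ
  have hd : ∀ Y ∈ (bᶜ.powerset : Set (Finset V)), Disjoint Y t := by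
    intro Y hY
    have : Disjoint Y b := Finset.subset_compl_iff_disjoint_right.1 (Finset.mem_powerset.1 hY)
    exact this.mono_right h
  have e := congrArg (· \ t) hYZ
  simpa [Finset.union_sdiff_right, Finset.sdiff_eq_self_of_disjoint (hd Y hY),
    Finset.sdiff_eq_self_of_disjoint (hd Z hZ)] using e

variable {ι : Type*} [Fintype ι]

/-- A covering by `2 ^ k` faces of codimension `k` is a partition, because the sizes of the faces
add up to the number of vertices. -/
theorem card_filter_inter_eq_one {b t : ι → Finset V} {k : ℕ} (hι : Fintype.card ι = 2 ^ k)
    (ht : ∀ i, t i ⊆ b i)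
    (hb : ∀ i, (b i).card = k) (hcov : ∀ X : Finset V, ∃ i, X ∩ b i = t i) (X : Finset V) :
    (Finset.univ.filter fun i => X ∩ b i = t i).card = 1 := by
  have hk : k ≤ Fintype.card V := by
    obtain ⟨i, -⟩ := hcov ∅
    rw [← hb i]
    exact Finset.card_le_univ _
  have hsum := Finset.sum_card_bipartiteAbove_eq_sum_card_bipartiteBelow
    (s := (Finset.univ : Finset (Finset V))) (t := (Finset.univ : Finset ι))
    (fun X i => X ∩ b i = t i)
  simp only [Finset.bipartiteAbove, Finset.bipartiteBelow, card_filter_inter_eq (ht _), hb,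
    Finset.sum_const, Finset.card_univ, hι, smul_eq_mul, ← pow_add, Nat.add_sub_cancel' hk] at hsum
  have hone : ∑ _X : Finset V, 1 = 2 ^ Fintype.card V := by simp
  have hle : ∀ X ∈ (Finset.univ : Finset (Finset V)),
      1 ≤ (Finset.univ.filter fun i => X ∩ b i = t i).card := fun X _ =>
    Finset.card_pos.2 ((hcov X).imp fun i hi => by simpa using hi)
  exact ((Finset.sum_eq_sum_iff_of_le hle).1 (hone.trans hsum.symm) X (Finset.mem_univ X)).symm

/-- A covering of the cube by 16 pairs of antipodal faces of codimension 5 with distinct blocks is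
a signed system. -/
theorem signedSystem_of_cover {B N : ι → Finset V} (hι : Fintype.card ι = 16)
    (hB : ∀ i, (B i).card = 5) (hinj : Function.Injective B) (hN : ∀ i, N i ⊆ B i)
    (heven : ∀ i, Even (N i).card)
    (hcov : ∀ X : Finset V, ∃ i, X ∩ B i = N i ∨ X ∩ B i = B i \ N i) :
    SignedSystem (Finset.univ.image fun i => (B i, N i)) := by
  classical
  set b : ι × Bool → Finset V := fun x => B x.1 with hb
  set t : ι × Bool → Finset V := fun x => bif x.2 then B x.1 \ N x.1 else N x.1 with ht
  have htb : ∀ x, t x ⊆ b x := by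
    rintro ⟨i, c⟩
    cases c
    exacts [hN i, Finset.sdiff_subset]
  have hone := card_filter_inter_eq_one (b := b) (t := t) (k := 5)
    (by rw [Fintype.card_prod, hι, Fintype.card_bool]; norm_num) htb (fun x => hB x.1) (by
      intro X
      obtain ⟨i, h | h⟩ := hcov X
      exacts [⟨(i, false), h⟩, ⟨(i, true), h⟩])
  have hinj' : Function.Injective fun i => (B i, N i) := fun i j h => hinj (congrArg Prod.fst h)
  refine ⟨?_, ?_, ?_, ?_, ?_, ?_, ?_⟩
  · rw [Finset.card_image_of_injective _ hinj', Finset.card_univ, hι]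
  · simpa [Finset.forall_mem_image] using hB
  · simpa [Finset.forall_mem_image] using hN
  · simpa [Finset.forall_mem_image] using heven
  · simp only [Finset.forall_mem_image]
    intro i _ j _ h
    rw [hinj h]
  · simp only [Finset.forall_mem_image]
    intro i _ j _ hij
    have hij' : i ≠ j := fun h => hij (by rw [h])
    obtain ⟨v, hv, h1⟩ := exists_mem_inter_of_ne htb hone (i := (i, false)) (j := (j, true))
      fun h => hij' (congrArg Prod.fst h)
    obtain ⟨w, hw, h2⟩ := exists_mem_inter_of_ne htb hone (i := (i, false)) (j := (j, false))
      fun h => hij' (congrArg Prod.fst h)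
    refine ⟨v, hv, w, hw, ?_, h2⟩
    have hvj : v ∈ B j := (Finset.mem_inter.1 hv).2
    simp only [ht, cond_true, cond_false, Finset.mem_sdiff] at h1
    tauto
  · intro S hS
    have hsum := sum_neg_one_pow_card hone (S := S) (Finset.card_pos.1 (by omega))
    rw [Finset.sum_filter, Fintype.sum_prod_type] at hsum
    simp only [Fintype.sum_bool, ht, hb, cond_true, cond_false] at hsum
    have hterm : ∀ i, ((if S ⊆ B i ∧ B i \ N i ⊆ S then (-1 : ℤ) ^ (B i \ N i).card else 0) +
        if S ⊆ B i ∧ N i ⊆ S then (-1 : ℤ) ^ (N i).card else 0) =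
        (if S ⊆ B i ∧ N i ⊆ S then 1 else 0) - if S ⊆ B i ∧ ¬ N i ⊆ S then 1 else 0 := by
      intro i
      by_cases hSB : S ⊆ B i
      · obtain ⟨v, hv, hBv⟩ := exists_eq_insert_of_subset hSB (by rw [hS, hB i])
        have e1 : ∀ M ⊆ B i, (M ⊆ S ↔ v ∉ M) := by
          intro M hM
          refine ⟨fun h hvM => hv (h hvM), fun h x hx => ?_⟩
          have := hM hx
          rw [hBv] at this
          exact (Finset.mem_insert.1 this).resolve_left fun e => h (e ▸ hx)
        have hvB : v ∈ B i := by rw [hBv]; exact Finset.mem_insert_self v S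
        have hodd : Odd (B i \ N i).card := by
          rw [Finset.card_sdiff_of_subset (hN i), hB i,
            Nat.odd_sub (by rw [← hB i]; exact Finset.card_le_card (hN i))]
          exact iff_of_true (by decide) (heven i)
        have e2 := e1 _ (hN i)
        have e3 := e1 _ (Finset.sdiff_subset (s := B i) (t := N i))
        rw [(heven i).neg_one_pow, hodd.neg_one_pow]
        by_cases hvN : v ∈ N i <;> simp [hSB, hvN, hvB, e2, e3]
      · simp [hSB]
    rw [Finset.sum_congr rfl fun i _ => hterm i, Finset.sum_sub_distrib, Finset.sum_boole,
      Finset.sum_boole, sub_eq_zero] at hsum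
    rw [Finset.filter_image, Finset.filter_image, Finset.card_image_of_injective _ hinj',
      Finset.card_image_of_injective _ hinj']
    exact_mod_cast hsum

theorem UnitradeEquiv.of_map {V₁ V₂ V₃ : Type*} {A : Finset (Finset V₁)} {U : Finset (Finset V₂)}
    (e : V₂ ↪ V₃) (hA : ∀ i, ∃ u ∈ A, i ∈ u)
    (h : UnitradeEquiv A (U.map (Finset.mapEmbedding e).toEmbedding)) : UnitradeEquiv A U := by
  obtain ⟨f, hf⟩ := h
  have hex : ∀ i, ∃ v, e v = f i := by
    intro i
    obtain ⟨u, hu, hi⟩ := hA i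
    have h1 : u.map f ∈ U.map (Finset.mapEmbedding e).toEmbedding := by
      rw [hf]
      exact Finset.mem_map_of_mem (Finset.mapEmbedding f).toEmbedding hu
    obtain ⟨B, -, hB⟩ := Finset.mem_map.1 h1
    have h2 : f i ∈ B.map e := by
      have : B.map e = u.map f := hB
      rw [this]
      exact Finset.mem_map_of_mem f hi
    obtain ⟨v, -, hv⟩ := Finset.mem_map.1 h2
    exact ⟨v, hv⟩
  choose g hg using hex
  have hginj : Function.Injective g := fun i j h => f.injective (by rw [← hg, ← hg, h])
  refine ⟨⟨g, hginj⟩, Finset.map_injective (Finset.mapEmbedding e).toEmbedding ?_⟩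
  have hfg : (⟨g, hginj⟩ : V₁ ↪ V₂).trans e = f := by
    ext i
    exact hg i
  rw [hf]
  ext B
  simp [Finset.mem_map, Finset.map_map, hfg]

theorem exists_mem_unitradeE : ∀ i, ∃ u ∈ unitradeE, i ∈ u := by decide +kernel

theorem exists_mem_unitradeF : ∀ i, ∃ u ∈ unitradeF, i ∈ u := by decide +kernel

/-- The blocks of a covering of the cube by 16 pairs of antipodal faces of codimension 5 form a copy
of `E` or of `F`. -/
theorem unitradeEquiv_of_cover {B N : ι → Finset V} (hι : Fintype.card ι = 16)
    (hB : ∀ i, (B i).card = 5) (hinj : Function.Injective B) (hN : ∀ i, N i ⊆ B i)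
    (hcov : ∀ X : Finset V, ∃ i, X ∩ B i = N i ∨ X ∩ B i = B i \ N i) :
    UnitradeEquiv unitradeE (Finset.univ.image B) ∨
      UnitradeEquiv unitradeF (Finset.univ.image B) := by
  -- choose the representatives of even size
  set M : ι → Finset V := fun i => if Even (N i).card then N i else B i \ N i with hM
  have hT := signedSystem_of_cover (B := B) (N := M) hι hB hinj (by
      intro i
      simp only [hM]
      split_ifs
      exacts [hN i, Finset.sdiff_subset]) (by
      intro i
      simp only [hM]
      split_ifs with h
      · exact h
      · rw [Finset.card_sdiff_of_subset (hN i), hB i,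
          Nat.even_sub (by rw [← hB i]; exact Finset.card_le_card (hN i))]
        exact iff_of_false (by decide) h) (by
      intro X
      obtain ⟨i, hi⟩ := hcov X
      refine ⟨i, ?_⟩
      simp only [hM]
      split_ifs
      · exact hi
      · rw [Finset.sdiff_sdiff_eq_self (hN i)]
        exact hi.symm)
  set e : V ↪ ℕ := (Fintype.equivFin V).toEmbedding.trans Fin.valEmbedding
  have himage : (Finset.univ.image fun i => (B i, M i)).image Prod.fst = Finset.univ.image B := by
    rw [Finset.image_image]
    rfl
  have h := (hT.map e).unitradeEquiv_nat
  rw [image_fst_image_mapPair, himage] at h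
  exact h.imp (UnitradeEquiv.of_map e exists_mem_unitradeE)
    (UnitradeEquiv.of_map e exists_mem_unitradeF)

end

/-! ### The unitrades `E` and `F` and their hypergraphs -/

theorem isUnitrade_unitradeE : IsUnitrade 5 unitradeE := by
  unfold IsUnitrade
  decide +kernel

theorem isUnitrade_unitradeF : IsUnitrade 5 unitradeF := by
  unfold IsUnitrade
  decide +kernel

theorem Hypergraph.isUniform_ofBlocks {V : Type*} {U : Finset (Finset V)} {k : ℕ}
    (h : ∀ u ∈ U, u.card = k) : (Hypergraph.ofBlocks U).IsUniform k := by
  rintro e ⟨u, hu, rfl⟩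
  rw [Set.encard_coe_eq_coe_finsetCard, h u hu]

theorem Hypergraph.encard_edgeSet_ofBlocks {V : Type*} (U : Finset (Finset V)) :
    (Hypergraph.ofBlocks U).edgeSet.encard = U.card := by
  have : (Hypergraph.ofBlocks U).edgeSet = (fun u : Finset V => (u : Set V)) '' U := by
    ext e
    simp [Hypergraph.ofBlocks]
  rw [this, Function.Injective.encard_image Finset.coe_injective,
    Set.encard_coe_eq_coe_finsetCard]

/-- The block with the given mask. -/
def blockOfMask (m : ℕ) : Finset (Fin 8) := Finset.univ.filter fun i => m.testBit i = true

/-- The masks of `B` and `N` for signed blocks `(B, N)` over `unitradeE` that form a signed system.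
-/
def signedE : List (ℕ × ℕ) :=
  [(55, 0), (59, 9), (61, 29), (62, 24), (87, 68), (91, 80), (93, 92), (94, 78),
   (103, 101), (107, 65), (109, 12), (174, 6), (206, 202), (230, 66), (234, 40), (236, 132)]

/-- The masks of `B` and `N` for signed blocks `(B, N)` over `unitradeF` that form a signed system.
-/
def signedF : List (ℕ × ℕ) :=
  [(87, 0), (91, 9), (93, 29), (94, 24), (103, 34), (107, 105), (109, 5), (110, 72),
   (167, 132), (171, 33), (173, 172), (174, 10), (151, 147), (155, 139), (157, 129), (158, 144)]

/-- If the pairs of antipodal faces given by the signed blocks in `l` cover the cube, then the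
hypergraph of the blocks is not 2-DP-colorable: take the signs as the colorings of the edges. -/
theorem Hypergraph.not_isTwoDPColorable_ofBlocks {U : Finset (Finset (Fin 8))} {l : List (ℕ × ℕ)}
    (hU : ∀ p ∈ l, blockOfMask p.1 ∈ U)
    (hl : ∀ p ∈ l, ∀ q ∈ l, blockOfMask p.1 = blockOfMask q.1 → p.2 = q.2)
    (hcov : ∀ m < 2 ^ 8, ∃ p ∈ l, Nat.land m p.1 = p.2 ∨ Nat.land m p.1 = Nat.xor p.1 p.2) :
    ¬ (Hypergraph.ofBlocks U).IsTwoDPColorable := by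
  classical
  intro h
  obtain ⟨f, hf⟩ := h fun e v =>
    decide (∃ p ∈ l, (blockOfMask p.1 : Set (Fin 8)) = e.1 ∧ p.2.testBit v.1 = true)
  obtain ⟨m, hm⟩ := exists_bits_eq
    ((Finset.univ.filter fun v => f ⟨v, Set.mem_univ v⟩ = true).map Fin.valEmbedding)
  have hmf : ∀ v : Fin 8, m.testBit v = f ⟨v, Set.mem_univ v⟩ := by
    intro v
    rw [Bool.eq_iff_iff, ← mem_bits, hm]
    have := Finset.mem_map' Fin.valEmbedding (a := v)
      (s := Finset.univ.filter fun v => f ⟨v, Set.mem_univ v⟩ = true)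
    rw [Fin.valEmbedding_apply] at this
    rw [this]
    simp
  obtain ⟨p, hp, hX⟩ := hcov m (bits_subset_range.1 (by
    rw [hm]
    intro i hi
    obtain ⟨v, -, rfl⟩ := Finset.mem_map.1 hi
    exact Finset.mem_range.2 v.2))
  obtain ⟨h1, h2⟩ := hf ⟨blockOfMask p.1, blockOfMask p.1, hU p hp, rfl⟩
  have hsign : ∀ v : Fin 8, (∃ q ∈ l, (blockOfMask q.1 : Set (Fin 8)) = blockOfMask p.1 ∧
      q.2.testBit v = true) ↔ p.2.testBit v = true := by
    intro v
    constructor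
    · rintro ⟨q, hq, hqp, hv⟩
      rwa [hl q hq p hp (Finset.coe_injective hqp)] at hv
    · exact fun hv => ⟨p, hp, rfl, hv⟩
  have hmask : ∀ v ∈ blockOfMask p.1, p.1.testBit v = true := fun v hv =>
    (Finset.mem_filter.1 hv).2
  rcases hX with hX | hX
  · refine h1 (funext fun v => ?_)
    have hv := congrArg (fun k => k.testBit v.1) hX
    change (m &&& p.1).testBit v.1 = p.2.testBit v.1 at hv
    rw [Nat.testBit_and, hmask v.1 v.2, Bool.and_true, hmf] at hv
    rw [Bool.eq_iff_iff, decide_eq_true_iff, hsign, ← hv]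
    rfl
  · refine h2 (funext fun v => ?_)
    have hv := congrArg (fun k => k.testBit v.1) hX
    change (m &&& p.1).testBit v.1 = (p.1 ^^^ p.2).testBit v.1 at hv
    rw [Nat.testBit_and, Nat.testBit_xor, hmask v.1 v.2, Bool.and_true, hmf, Bool.true_xor] at hv
    rw [Bool.eq_iff_iff, Bool.not_eq_true', decide_eq_false_iff_not, hsign,
      Bool.not_eq_true, ← Bool.not_eq_true', ← hv]
    rfl

theorem not_isTwoDPColorable_unitradeE :
    ¬ (Hypergraph.ofBlocks unitradeE).IsTwoDPColorable :=
  Hypergraph.not_isTwoDPColorable_ofBlocks (l := signedE) (by decide +kernel) (by decide +kernel)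
    (by decide +kernel)

theorem not_isTwoDPColorable_unitradeF :
    ¬ (Hypergraph.ofBlocks unitradeF).IsTwoDPColorable :=
  Hypergraph.not_isTwoDPColorable_ofBlocks (l := signedF) (by decide +kernel) (by decide +kernel)
    (by decide +kernel)

/-- The point `7` lies in five blocks of `unitradeE`, but no point lies in exactly five blocks of
`unitradeF`. -/
theorem not_isomorphic_unitradeE_unitradeF :
    ¬ (Hypergraph.ofBlocks unitradeE).Isomorphic (Hypergraph.ofBlocks unitradeF) := by
  rintro ⟨φ, hφ⟩
  set σ : Fin 8 ≃ Fin 8 := (Equiv.Set.univ (Fin 8)).symm.trans (φ.trans (Equiv.Set.univ (Fin 8)))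
    with hσ
  have hmem : ∀ u : Finset (Fin 8), u ∈ unitradeE ↔ u.map σ.toEmbedding ∈ unitradeF := by
    intro u
    have h := hφ {x | x.1 ∈ u}
    have e1 : Subtype.val '' {x : (Hypergraph.ofBlocks unitradeE).vertexSet | x.1 ∈ u} = ↑u := by
      ext x
      exact ⟨fun ⟨y, hy, hyx⟩ => hyx ▸ hy, fun hx => ⟨⟨x, Set.mem_univ x⟩, hx, rfl⟩⟩
    have e2 : Subtype.val '' (φ '' {x : (Hypergraph.ofBlocks unitradeE).vertexSet | x.1 ∈ u}) =
        ↑(u.map σ.toEmbedding) := by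
      ext x
      rw [Finset.coe_map, Set.image_image]
      constructor
      · rintro ⟨y, hy, rfl⟩
        exact ⟨y.1, hy, rfl⟩
      · rintro ⟨y, hy, rfl⟩
        exact ⟨⟨y, Set.mem_univ y⟩, hy, rfl⟩
    rw [e1, e2] at h
    simpa [Hypergraph.ofBlocks, -Finset.coe_map] using h
  have hcard : (unitradeF.filter fun u => σ 7 ∈ u).card = 5 := by
    have e : unitradeF.filter (fun u => σ 7 ∈ u) =
        (unitradeE.filter fun u => 7 ∈ u).map (Finset.mapEmbedding σ.toEmbedding).toEmbedding := by
      ext u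
      simp only [Finset.mem_filter, Finset.mem_map, RelEmbedding.coe_toEmbedding,
        Finset.mapEmbedding_apply]
      constructor
      · rintro ⟨hu, h7⟩
        have hu' : (u.map σ.symm.toEmbedding).map σ.toEmbedding = u := by
          rw [Finset.map_map]
          ext x
          simp
        refine ⟨u.map σ.symm.toEmbedding, ⟨(hmem _).2 (hu'.symm ▸ hu), ?_⟩, hu'⟩
        rw [Finset.mem_map_equiv]
        exact h7
      · rintro ⟨w, ⟨hw, h7⟩, rfl⟩
        exact ⟨(hmem w).1 hw, Finset.mem_map_of_mem σ.toEmbedding h7⟩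
    rw [e, Finset.card_map]
    decide +kernel
  have hF : ∀ j : Fin 8, (unitradeF.filter fun u => j ∈ u).card ≠ 5 := by decide +kernel
  exact hF _ hcard

/-! ### Antipodal splittings -/

/-- The positions of the symbol `1` of a face. -/
def Face.ones {n : ℕ} (a : Face n) : Finset (Fin n) :=
  Finset.univ.filter fun i => a i = some true

section

variable {n : ℕ}

theorem Face.mem_block {a : Face n} {i : Fin n} : i ∈ a.block ↔ a i ≠ none := by
  simp [Face.block]

theorem Face.mem_ones {a : Face n} {i : Fin n} : i ∈ a.ones ↔ a i = some true := by
  simp [Face.ones]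

theorem Face.ones_subset (a : Face n) : a.ones ⊆ a.block := fun i hi => by
  rw [Face.mem_block, Face.mem_ones.1 hi]
  simp

theorem Face.ext_block_ones {a b : Face n} (h1 : a.block = b.block) (h2 : a.ones = b.ones) :
    a = b := by
  funext i
  have e1 := Finset.ext_iff.1 h1 i
  have e2 := Finset.ext_iff.1 h2 i
  rw [Face.mem_block, Face.mem_block] at e1
  rw [Face.mem_ones, Face.mem_ones] at e2
  rcases ha : a i with _ | _ | _ <;> rcases hb : b i with _ | _ | _ <;> simp_all

theorem Face.card_block_add_dim (a : Face n) : a.dim + a.block.card = n := by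
  have := Finset.card_filter_add_card_filter_not (s := (Finset.univ : Finset (Fin n)))
    (fun i => a i = none)
  rwa [Finset.card_univ, Fintype.card_fin] at this

theorem Face.inter_block_eq_ones {a : Face n} {X : Finset (Fin n)}
    (h : (fun i => decide (i ∈ X)) ∈ a.verts) : X ∩ a.block = a.ones := by
  ext i
  rw [Finset.mem_inter, Face.mem_block, Face.mem_ones]
  have hi := h i
  rcases ha : a i with _ | _ | _
  · simp
  · simpa using hi _ ha
  · simpa using hi _ ha

theorem Face.parallel_iff {a b : Face n} : a.Parallel b ↔ a.block = b.block := by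
  simp only [Face.Parallel, Finset.ext_iff, Face.mem_block, not_iff_not, Ne]

theorem Face.Antipodal.ones_eq {a b : Face n} (h : a.Antipodal b) :
    b.ones = a.block \ a.ones := by
  obtain ⟨hpar, hanti, -⟩ := h
  have hx := hanti (fun i => decide (a i = some true)) (fun i c hc => by
    change decide (a i = some true) = c
    rw [hc]
    cases c <;> simp)
  ext i
  rw [Finset.mem_sdiff, Face.mem_block, Face.mem_ones, Face.mem_ones]
  have hi := hx i
  have hp := hpar i
  simp only [Cube.antipode] at hi
  rcases hb : b i with _ | _ | _
  · simp [hp.2 hb]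
  · have := hi _ hb
    simp_all
  · have := hi _ hb
    have ha : a i ≠ none := fun h => by simp [hp.1 h] at hb
    simp_all

/-- In an antipodal splitting, each face occurs together with its antipodal face: otherwise, the
Fourier coefficient at its block would be `1` or `-1`. -/
theorem IsAntipodalSplitting.exists_ne {A : Finset (Face n)} (hA : IsAntipodalSplitting 5 n A)
    {a : Face n} (ha : a ∈ A) : ∃ b ∈ A, b ≠ a ∧ b.block = a.block := by
  by_contra! hc
  have h5 : ∀ b ∈ A, b.block.card = 5 := fun b hb => by
    have h1 := hA.dim_eq b hb
    have h2 := b.card_block_add_dim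
    omega
  have hone := card_filter_inter_eq_one (ι := A) (b := fun b => b.1.block) (t := fun b => b.1.ones)
    (k := 5) (by rw [Fintype.card_coe, hA.card_eq]) (fun b => b.1.ones_subset)
    (fun b => h5 _ b.2) (fun X => by
      obtain ⟨b, hb, hX⟩ := hA.covers fun i => decide (i ∈ X)
      exact ⟨⟨b, hb⟩, Face.inter_block_eq_ones hX⟩)
  have hsum := sum_neg_one_pow_card hone (S := a.block)
    (Finset.card_pos.1 (by rw [h5 a ha]; norm_num))
  have hfilter : (Finset.univ.filter fun b : A => a.block ⊆ b.1.block ∧ b.1.ones ⊆ a.block) =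
      {⟨a, ha⟩} := by
    ext b
    simp only [Finset.mem_filter, Finset.mem_univ, true_and, Finset.mem_singleton]
    constructor
    · rintro ⟨h, -⟩
      by_contra hne
      exact hc b.1 b.2 (fun h => hne (Subtype.ext h))
        (Finset.eq_of_subset_of_card_le h (by rw [h5 _ b.2, h5 a ha])).symm
    · rintro rfl
      exact ⟨subset_rfl, a.ones_subset⟩
  rw [hfilter, Finset.sum_singleton] at hsum
  exact pow_ne_zero _ (by norm_num) hsum

theorem IsAntipodalSplitting.card_blockSystem {A : Finset (Face n)}
    (hA : IsAntipodalSplitting 5 n A) : (blockSystem A).card = 16 := by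
  have hfib : ∀ B ∈ blockSystem A, (A.filter fun a => a.block = B).card = 2 := by
    intro B hB
    obtain ⟨a, ha, rfl⟩ := Finset.mem_image.1 hB
    obtain ⟨b, hb, hne, hba⟩ := hA.exists_ne ha
    have : (A.filter fun c => c.block = a.block) = {a, b} := by
      ext c
      simp only [Finset.mem_filter, Finset.mem_insert, Finset.mem_singleton]
      constructor
      · rintro ⟨hc, hca⟩
        by_contra! hcn
        have e1 := (hA.antipodal a ha b hb hne.symm (Face.parallel_iff.2 hba.symm)).ones_eq
        have e2 := (hA.antipodal a ha c hc hcn.1.symm (Face.parallel_iff.2 hca.symm)).ones_eq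
        exact hcn.2 (Face.ext_block_ones (hca.trans hba.symm) (e2.trans e1.symm))
      · rintro (rfl | rfl)
        exacts [⟨ha, rfl⟩, ⟨hb, hba⟩]
    rw [this, Finset.card_pair hne.symm]
  have h := Finset.card_eq_sum_card_image Face.block A
  have hsum : ∑ B ∈ A.image Face.block, (A.filter fun a => a.block = B).card =
      (blockSystem A).card * 2 := by
    exact (Finset.sum_congr rfl hfib).trans (by rw [Finset.sum_const, smul_eq_mul])
  rw [hA.card_eq, hsum] at h
  omega

theorem IsAntipodalSplitting.unitradeEquiv {A : Finset (Face n)}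
    (hA : IsAntipodalSplitting 5 n A) :
    UnitradeEquiv unitradeE (blockSystem A) ∨ UnitradeEquiv unitradeF (blockSystem A) := by
  have hex : ∀ B : blockSystem A, ∃ a ∈ A, a.block = B.1 := fun B => Finset.mem_image.1 B.2
  choose r hrA hr using hex
  have h := unitradeEquiv_of_cover (ι := blockSystem A) (B := Subtype.val)
    (N := fun B => (r B).ones) (by rw [Fintype.card_coe, hA.card_blockSystem]) (fun B => by
      have h1 := hA.dim_eq _ (hrA B)
      have h2 := (r B).card_block_add_dim
      rw [hr] at h2
      omega) Subtype.val_injective (fun B => by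
      have := (r B).ones_subset
      rwa [hr] at this) (fun X => by
      obtain ⟨a, ha, hX⟩ := hA.covers fun i => decide (i ∈ X)
      have hXa := Face.inter_block_eq_ones hX
      refine ⟨⟨a.block, Finset.mem_image_of_mem _ ha⟩, ?_⟩
      set B : blockSystem A := ⟨a.block, Finset.mem_image_of_mem _ ha⟩ with hB
      have hrB : (r B).block = a.block := hr B
      by_cases hra : r B = a
      · exact Or.inl (by rw [hra]; exact hXa)
      · right
        have e := (hA.antipodal _ (hrA B) a ha hra (Face.parallel_iff.2 hrB)).ones_eq
        rw [hrB] at e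
        exact hXa.trans e)
  have himage : (Finset.univ : Finset (blockSystem A)).image Subtype.val = blockSystem A := by
    rw [Finset.univ_eq_attach, Finset.attach_image_val]
  rwa [himage] at h

end

/-! ### Hypergraphs that are not 2-DP-colorable -/

namespace Hypergraph

/-- An injection of the vertices that sends the blocks of `U` to the edges of `H` is an isomorphism
onto `H` without its isolated vertices. -/
theorem isomorphic_deleteIsolated {V α : Type*} {U : Finset (Finset V)} {H : Hypergraph α}
    {g : V → α} (hg : Function.Injective g) (hU : ∀ i, ∃ u ∈ U, i ∈ u)
    (hH : ∀ e, e ∈ H.edgeSet ↔ ∃ u ∈ U, g '' (u : Set V) = e) :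
    (ofBlocks U).Isomorphic H.deleteIsolated := by
  have hmem : ∀ i, g i ∈ H.deleteIsolated.vertexSet := by
    intro i
    obtain ⟨u, hu, hi⟩ := hU i
    exact Set.mem_sUnion.2 ⟨_, (hH _).2 ⟨u, hu, rfl⟩, Set.mem_image_of_mem g hi⟩
  have hbij : Function.Bijective fun i : (ofBlocks U).vertexSet =>
      (⟨g i.1, hmem i.1⟩ : H.deleteIsolated.vertexSet) := by
    constructor
    · intro i j h
      exact Subtype.ext (hg (congrArg Subtype.val h))
    · rintro ⟨x, hx⟩
      obtain ⟨e, he, hxe⟩ := Set.mem_sUnion.1 hx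
      obtain ⟨u, -, rfl⟩ := (hH e).1 he
      obtain ⟨i, -, rfl⟩ := hxe
      exact ⟨⟨i, Set.mem_univ i⟩, rfl⟩
  refine ⟨Equiv.ofBijective _ hbij, fun s => ?_⟩
  have himage : Subtype.val '' (Equiv.ofBijective _ hbij '' s) = g '' (Subtype.val '' s) := by
    rw [Set.image_image, Set.image_image]
    rfl
  rw [himage]
  change (∃ u ∈ U, (u : Set V) = Subtype.val '' s) ↔ g '' (Subtype.val '' s) ∈ H.edgeSet
  rw [hH]
  simp only [hg.image_injective.eq_iff]

/-- If no 2-coloring avoids all the colorings `φ_e` and `φ_e ⊕ 1`, then the corresponding pairs of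
antipodal faces cover the cube. -/
theorem isomorphic_of_not_isTwoDPColorable {α : Type*} {H : Hypergraph α}
    (hfin : H.vertexSet.Finite) (h5 : H.IsUniform 5) (h16 : H.edgeSet.encard = 16)
    (h : ¬ H.IsTwoDPColorable) :
    (ofBlocks unitradeE).Isomorphic H.deleteIsolated ∨
      (ofBlocks unitradeF).Isomorphic H.deleteIsolated := by
  classical
  have := hfin.fintype
  have hefin : H.edgeSet.Finite := Set.finite_of_encard_eq_coe h16
  have := hefin.fintype
  unfold IsTwoDPColorable at h
  push Not at h
  obtain ⟨Φ, hΦ⟩ := h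
  set B : H.edgeSet → Finset H.vertexSet := fun e => Finset.univ.filter fun v => v.1 ∈ e.1 with hB
  have hBe : ∀ e, Subtype.val '' (B e : Set H.vertexSet) = e.1 := by
    intro e
    ext x
    constructor
    · rintro ⟨v, hv, rfl⟩
      exact (Finset.mem_filter.1 hv).2
    · intro hx
      exact ⟨⟨x, H.subset_vertexSet_of_mem_edgeSet' e.2 hx⟩,
        Finset.mem_filter.2 ⟨Finset.mem_univ _, hx⟩, rfl⟩
  have hcover := unitradeEquiv_of_cover (ι := H.edgeSet) (B := B)
    (N := fun e => Finset.univ.filter fun v => ∃ hv : v.1 ∈ e.1, Φ e ⟨v.1, hv⟩ = true)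
    (by
      rw [← Nat.card_eq_fintype_card, Nat.card_coe_set_eq, Set.ncard, h16]
      rfl)
    (fun e => by
      have h1 := h5 e.1 e.2
      rw [← hBe e, Subtype.val_injective.encard_image, Set.encard_coe_eq_coe_finsetCard] at h1
      exact_mod_cast h1)
    (fun e e' hee => Subtype.ext (by rw [← hBe e, hee, hBe e']))
    (fun e v hv => by
      obtain ⟨hv', -⟩ := (Finset.mem_filter.1 hv).2
      exact Finset.mem_filter.2 ⟨Finset.mem_univ _, hv'⟩)
    (fun X => by
      obtain ⟨e, he⟩ := hΦ fun v => decide (v ∈ X)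
      refine ⟨e, ?_⟩
      by_cases heq : H.restrictColoring (fun v => decide (v ∈ X)) e = Φ e
      · left
        ext v
        simp only [hB, Finset.mem_inter, Finset.mem_filter, Finset.mem_univ, true_and]
        by_cases hv : v.1 ∈ e.1
        · have := congrFun heq ⟨v.1, hv⟩
          simp only [restrictColoring] at this
          simp [hv, ← this]
        · simp [hv]
      · right
        have heq' := he heq
        ext v
        simp only [hB, Finset.mem_inter, Finset.mem_filter, Finset.mem_univ, true_and,
          Finset.mem_sdiff]
        by_cases hv : v.1 ∈ e.1
        · have := congrFun heq' ⟨v.1, hv⟩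
          simp only [restrictColoring] at this
          have e2 : Φ e ⟨v.1, hv⟩ = !decide (v ∈ X) := by rw [this, Bool.not_not]
          simp [hv, e2]
        · simp [hv])
  have hfinal : ∀ U : Finset (Finset (Fin 8)), (∀ i, ∃ u ∈ U, i ∈ u) →
      UnitradeEquiv U (Finset.univ.image B) → (ofBlocks U).Isomorphic H.deleteIsolated := by
    rintro U hU ⟨f, hf⟩
    refine isomorphic_deleteIsolated (g := fun i => (f i).1)
      (Subtype.val_injective.comp f.injective) hU fun e => ?_
    have hcomp : ∀ u : Finset (Fin 8), (fun i => (f i).1) '' (u : Set (Fin 8)) =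
        Subtype.val '' ((u.map f : Finset H.vertexSet) : Set H.vertexSet) := by
      intro u
      rw [Finset.coe_map, Set.image_image]
    simp only [hcomp]
    constructor
    · intro he
      have h1 := Finset.mem_image_of_mem B (Finset.mem_univ ⟨e, he⟩)
      rw [hf] at h1
      obtain ⟨u, hu, hue⟩ := Finset.mem_map.1 h1
      have hue' : u.map f = B ⟨e, he⟩ := hue
      exact ⟨u, hu, by rw [hue', hBe]⟩
    · rintro ⟨u, hu, rfl⟩
      have h1 : u.map f ∈ Finset.univ.image B := by
        rw [hf]
        exact Finset.mem_map_of_mem (Finset.mapEmbedding f).toEmbedding hu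
      obtain ⟨e, -, he⟩ := Finset.mem_image.1 h1
      rw [← he, hBe]
      exact e.2
  exact hcover.imp (hfinal _ exists_mem_unitradeE) (hfinal _ exists_mem_unitradeF)

end Hypergraph

theorem theorem2 :
    -- `E` and `F` are 5-unitrades, and the block system of each antipodal 5-splitting is
    -- equivalent to `E` or to `F`
    (IsUnitrade 5 unitradeE ∧ IsUnitrade 5 unitradeF ∧
      ∀ (n : ℕ) (A : Finset (Face n)), IsAntipodalSplitting 5 n A →
        UnitradeEquiv unitradeE (blockSystem A) ∨ UnitradeEquiv unitradeF (blockSystem A)) ∧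
    -- `E` and `F` give two non-isomorphic non-2-DP-colorable 5-uniform hypergraphs with 16 edges
    ((Hypergraph.ofBlocks unitradeE).IsUniform 5 ∧
      (Hypergraph.ofBlocks unitradeE).edgeSet.encard = 16 ∧
      ¬ (Hypergraph.ofBlocks unitradeE).IsTwoDPColorable ∧
      (Hypergraph.ofBlocks unitradeF).IsUniform 5 ∧
      (Hypergraph.ofBlocks unitradeF).edgeSet.encard = 16 ∧
      ¬ (Hypergraph.ofBlocks unitradeF).IsTwoDPColorable ∧
      ¬ (Hypergraph.ofBlocks unitradeE).Isomorphic (Hypergraph.ofBlocks unitradeF)) ∧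
    -- up to isomorphism and isolated vertices there are no others
    (∀ (α : Type*) (H : Hypergraph α), H.vertexSet.Finite → H.IsUniform 5 →
      H.edgeSet.encard = 16 → ¬ H.IsTwoDPColorable →
        (Hypergraph.ofBlocks unitradeE).Isomorphic H.deleteIsolated ∨
          (Hypergraph.ofBlocks unitradeF).Isomorphic H.deleteIsolated) := by
  refine ⟨⟨isUnitrade_unitradeE, isUnitrade_unitradeF, fun n A hA => hA.unitradeEquiv⟩,
    ⟨Hypergraph.isUniform_ofBlocks isUnitrade_unitradeE.1, ?_, not_isTwoDPColorable_unitradeE,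
      Hypergraph.isUniform_ofBlocks isUnitrade_unitradeF.1, ?_, not_isTwoDPColorable_unitradeF,
      not_isomorphic_unitradeE_unitradeF⟩,
    fun α H hfin h5 h16 h => Hypergraph.isomorphic_of_not_isTwoDPColorable hfin h5 h16 h⟩
  · rw [Hypergraph.encard_edgeSet_ofBlocks, card_unitradeE]
    rfl
  · rw [Hypergraph.encard_edgeSet_ofBlocks, card_unitradeF]
    rfl
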